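/- Let $n\ge 1$, let $K_n$ be the complete graph (without loops) on the vertex set $V=\{0,\dots,n-1\}$, and let $\tau$ be a (non-empty, not necessarily spanning) subtree of $K_n$. The algorithm $\textbf{Seeded-Tree}(n,\tau)$ is the following. Put $V_X=V(\tau)$ and $E_X=E(\tau)$. While $V_X\neq V$, choose $v\in V\setminus V_X$ uniformly at random, run a simple random walk on $K_n$ from $v$ until it first visits $V_X$, erase its loops in the order in which they are created, and add the vertices and edges of the resulting path to $V_X$ and $E_X$ (this is Wilson's algorithm on $K_n$ with initial tree $\tau$). Then draw a uniformly random permutation $\sigma$ of $V$ by a Fisher–Yates shuffle, and output the graph on $V$ with edges $\{\sigma(a),\sigma(b)\}$, $\{a,b\}\in E_X$. For a tree $T$ with vertex set $V$ let $N_\tau(T)$ be the number of subgraphs of $T$ that are isomorphic to $\tau$. Then Seeded-Tree$(n,\tau)$ halts almost surely, its output is almost surely a tree with vertex set $V$, and for each such tree $T$ $$\mathbb P\big(\text{Seeded-Tree}(n,\tau)\text{ outputs }T\big)=\frac{N_\tau(T)}{\sum_{T'}N_\tau(T')},$$ where $T'$ runs over all trees with vertex set $V$. Moreover its expected running time is $O(n)$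 uniformly in $\tau$: there is an absolute constant $C$ such that for all $n$ and $\tau$ (given by a list of its vertices and a list of its edges) the expected number of elementary steps is at most $Cn$. Here an elementary step reads and writes a bounded number of memory cells and draws at most one uniformly random element. Each of the following costs at least one step: the initialisation of an array cell, the reading of a vertex or edge of $\tau$, a choice of a starting vertex, a step of the random walk, the removal of a vertex from the path when a loop is erased, the addition of a path vertex (with its edge) to the tree, a transposition of the shuffle, and the relabelling of an edge. -/

import Mathlib

open scoped ENNReal NNReal

noncomputable section

namespace SeededTree

/-! ## The randomised procedure, one elementary operation at a time

The memory consists of arrays indexed by the vertices `0, …, n - 1` and of stacks (lists that are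
only accessed at their head).  One execution of `step` inspects and changes a bounded number of
array cells and stack heads, and draws at most one uniform random element.  The running time is the
number of executed steps. -/

/-- The program counter. -/
inductive Phase (n : ℕ) where
  /-- initialise the arrays; `k` cells remain -/
  | init (k : ℕ)
  /-- put the vertices of the initial tree into `V_X` -/
  | loadVertices
  /-- put the edges of the initial tree into `E_X` -/
  | loadEdges
  /-- if `V_X ≠ V`, choose a vertex outside `V_X` uniformly at random -/
  | choose
  /-- make one step of the random walk -/
  | walk
  /-- erase the loop that was just closed at `u`, one vertex at a time -/
  | erase (u : Fin n)
  /-- move the loop-erased path into the tree, one vertex at a time -/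
  | attach
  /-- Fisher--Yates shuffle of the labels; the cells `0, …, i - 1` remain to be treated -/
  | shuffle (i : Fin (n + 1))
  /-- apply the shuffled labels, one edge at a time -/
  | relabel
  /-- halted -/
  | done

/-- The memory of the procedure on the vertex set `Fin n`. -/
structure Config (n : ℕ) where
  /-- program counter -/
  phase : Phase n
  /-- input: vertices of the initial tree that are still to be read -/
  inV : List (Fin n)
  /-- input: edges of the initial tree that are still to be read -/
  inE : List (Fin n × Fin n)
  /-- An arrangement of all vertices in an array, stored together with the inverse array that gives
  the slot `slot.symm v` of a vertex `v`. -/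
  slot : Equiv.Perm (Fin n)
  /-- The first `free` slots hold the vertices outside `V_X`, the other slots those of `V_X`. -/
  free : Fin (n + 1)
  /-- the edges `E_X` of the current tree -/
  edges : List (Fin n × Fin n)
  /-- the current loop-erased path; its head is the position of the walker -/
  path : List (Fin n)
  /-- `mark v` records whether `v` lies on `path` -/
  mark : Fin n → Bool
  /-- the new label `label v` of each vertex `v` -/
  label : Equiv.Perm (Fin n)
  /-- output: edges of the relabelled tree -/
  out : List (Fin n × Fin n)

variable {n : ℕ}

/-- `v ∈ V_X`, tested by looking up the slot of `v`. -/
def Config.inTree (c : Config n) (v : Fin n) : Prop := (c.free : ℕ) ≤ (c.slot.symm v : ℕ)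

instance (c : Config n) (v : Fin n) : Decidable (c.inTree v) := by
  unfold Config.inTree; infer_instance

/-- `V_X ← V_X ∪ {v}`: exchange `v` with the last vertex outside `V_X` and shorten the first part of
the arrangement by one slot. -/
def Config.addVertex (c : Config n) (v : Fin n) : Config n :=
  if h : (c.slot.symm v : ℕ) < (c.free : ℕ) then
    { c with
      slot := c.slot * Equiv.swap (c.slot.symm v) ⟨(c.free : ℕ) - 1, by have := c.free.isLt; omega⟩
      free := ⟨(c.free : ℕ) - 1, by have := c.free.isLt; omega⟩ }
  else c

/-- Draw a uniform element of `s` and continue with `f`; if `s` is empty, continue with `c`. -/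
def draw {α : Type} (s : Finset α) (f : α → Config n) (c : Config n) : PMF (Config n) :=
  open Classical in if h : s.Nonempty then (PMF.uniformOfFinset s h).map f else PMF.pure c

/-- One elementary operation of: Wilson's algorithm on `G` from the given initial tree, followed by
a uniform shuffle of the labels. -/
def step (G : SimpleGraph (Fin n)) [DecidableRel G.Adj] (c : Config n) : PMF (Config n) :=
  match c.phase with
  | .init 0 => PMF.pure { c with phase := .loadVertices }
  | .init (k + 1) => PMF.pure { c with phase := .init k }
  | .loadVertices =>
    match c.inV with
    | [] => PMF.pure { c with phase := .loadEdges }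
    | v :: vs => PMF.pure { c.addVertex v with inV := vs }
  | .loadEdges =>
    match c.inE with
    | [] => PMF.pure { c with phase := .choose }
    | e :: es => PMF.pure { c with inE := es, edges := e :: c.edges }
  | .choose =>
    draw (Finset.univ.filter fun i : Fin n => (i : ℕ) < (c.free : ℕ))
      (fun i => { c with
        phase := .walk
        path := [c.slot i]
        mark := Function.update c.mark (c.slot i) true })
      { c with phase := .shuffle (Fin.last n) }
  | .walk =>
    match c.path with
    | [] => PMF.pure { c with phase := .choose }
    | v :: rest =>
      draw (G.neighborFinset v)
        (fun u =>
          if c.inTree u then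
            { c with phase := .attach, edges := (v, u) :: c.edges }
          else if c.mark u then
            { c with phase := .erase u }
          else
            { c with path := u :: v :: rest, mark := Function.update c.mark u true })
        c
  | .erase u =>
    match c.path with
    | [] => PMF.pure { c with phase := .choose }
    | v :: rest =>
      if v = u then PMF.pure { c with phase := .walk }
      else PMF.pure { c with path := rest, mark := Function.update c.mark v false }
  | .attach =>
    match c.path with
    | [] => PMF.pure { c with phase := .choose }
    | [v] => PMF.pure { c.addVertex v with path := [], mark := Function.update c.mark v false }
    | v :: w :: rest => PMF.pure { c.addVertex v with
        path := w :: rest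
        mark := Function.update c.mark v false
        edges := (w, v) :: c.edges }
  | .shuffle i =>
    if h : 0 < (i : ℕ) then
      draw (Finset.Iic (⟨(i : ℕ) - 1, by have := i.isLt; omega⟩ : Fin n))
        (fun j => { c with
          phase := .shuffle ⟨(i : ℕ) - 1, by have := i.isLt; omega⟩
          label := c.label *
            Equiv.swap (⟨(i : ℕ) - 1, by have := i.isLt; omega⟩ : Fin n) j })
        c
    else PMF.pure { c with phase := .relabel }
  | .relabel =>
    match c.edges with
    | [] => PMF.pure { c with phase := .done }
    | (a, b) :: es => PMF.pure { c with
        edges := es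
        out := (c.label a, c.label b) :: c.out }
  | .done => PMF.pure c

/-- The start: the input is the list of vertices and the list of edges of the initial tree. -/
def start (vs : List (Fin n)) (es : List (Fin n × Fin n)) : Config n where
  phase := .init n
  inV := vs
  inE := es
  slot := Equiv.refl _
  free := Fin.last n
  edges := []
  path := []
  mark := fun _ => false
  label := Equiv.refl _
  out := []

/-- Law of the memory of Seeded-Tree after `t` steps; the graph is the complete graph. -/
def law (vs : List (Fin n)) (es : List (Fin n × Fin n)) : ℕ → PMF (Config n)
  | 0 => PMF.pure (start vs es)
  | t + 1 => (law vs es t).bind (step (⊤ : SimpleGraph (Fin n)))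

/-- The graph on all `n` vertices whose edges are the ones written to the output. -/
def Config.result (c : Config n) : SimpleGraph (Fin n) :=
  SimpleGraph.fromEdgeSet {e | ∃ p ∈ c.out, e = s(p.1, p.2)}

/-- The probability that Seeded-Tree halts and outputs `T`. (The events increase with `t`, because
`done` is absorbing.) -/
def outputProb (vs : List (Fin n)) (es : List (Fin n × Fin n)) (T : SimpleGraph (Fin n)) : ℝ≥0∞ :=
  ⨆ t : ℕ, (law vs es t).toOuterMeasure {c | c.phase = .done ∧ c.result = T}

/-- The expected number of steps executed before halting: the sum over `t` of the probability that
step `t` is executed. It is infinite if the procedure fails to halt with positive probability. -/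
def expectedTime (vs : List (Fin n)) (es : List (Fin n × Fin n)) : ℝ≥0∞ :=
  ∑' t : ℕ, (law vs es t).toOuterMeasure {c | c.phase ≠ .done}

/-- `vs` and `es` list the vertices and the edges of `τ`, each of them once. -/
def Encodes (τ : (⊤ : SimpleGraph (Fin n)).Subgraph) (vs : List (Fin n))
    (es : List (Fin n × Fin n)) : Prop :=
  vs.Nodup ∧ (∀ v, v ∈ vs ↔ v ∈ τ.verts) ∧
  (es.map fun e => s(e.1, e.2)).Nodup ∧
  (∀ e, e ∈ es.map (fun e => s(e.1, e.2)) ↔ e ∈ τ.edgeSet)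

/-- The number of subgraphs of `T` that are isomorphic to `τ`. (Each of them is a tree if `τ` is.) -/
def copies (τ : (⊤ : SimpleGraph (Fin n)).Subgraph) (T : SimpleGraph (Fin n)) : ℕ :=
  Nat.card {S : T.Subgraph // Nonempty (S.coe ≃g τ.coe)}

end SeededTree

end

/-!
Wilson's algorithm on `n` vertices completes a tree with `k` vertices to a given spanning tree that
contains it with probability `n ^ (k + 1) / (n ^ n * k)`. We extend this formula to a bounded real
function of the whole memory, the value, that is preserved in expectation by every step and is the
indicator of the output `T` when the procedure has halted. In the middle of a walk, with `k`
vertices in the tree and a current path that has to follow the parent map of the given spanning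
tree, the value is a sum of such probabilities over the prefixes of the path to which an erased loop
may lead back. To allow for the shuffle, the value is averaged over the trees obtained from `T` by
the permutations of its vertices. Since the procedure halts almost surely, a bounded harmonic
function is determined by its values at the end, so the initial value is the probability of the
output `T`: up to a factor that does not depend on `T`, it is the number of permutations that map
the edges of `τ` to edges of `T`. Those that map `τ` onto a given copy form a coset of the
stabiliser of `τ`, so this number is proportional to the number of copies of `τ` in `T`.

The running time is bounded by a potential that decreases by at least one in expectation at every
step. For the random walk it rests on an explicit solution of the recurrence for the time until the
walk hits the tree.
-/

noncomputable section

namespace SeededTree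

/-! ## Expectations and Markov chains with countably many outcomes -/

section Markov

variable {α β : Type*}

/-- The expectation of `h` under the discrete law `p`, as a sum over all outcomes. -/
def expect (p : PMF α) (h : α → ℝ≥0∞) : ℝ≥0∞ := ∑' a, p a * h a

theorem expect_pure (a : α) (h : α → ℝ≥0∞) : expect (PMF.pure a) h = h a := by
  rw [expect, tsum_eq_single a fun b hb => by simp [hb]]
  simp

theorem expect_bind (p : PMF α) (f : α → PMF β) (h : β → ℝ≥0∞) :
    expect (p.bind f) h = expect p fun a => expect (f a) h := by
  simp_rw [expect, PMF.bind_apply, ← ENNReal.tsum_mul_right, ← ENNReal.tsum_mul_left, mul_assoc]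
  exact ENNReal.tsum_comm

theorem expect_map (p : PMF α) (f : α → β) (h : β → ℝ≥0∞) :
    expect (p.map f) h = expect p (h ∘ f) := by
  rw [← PMF.bind_pure_comp, expect_bind]
  simp [expect_pure, Function.comp_def]

theorem expect_uniformOfFinset {s : Finset α} (hs : s.Nonempty) (h : α → ℝ≥0∞) :
    expect (PMF.uniformOfFinset s hs) h = (∑ a ∈ s, h a) / (s.card : ℝ≥0∞) := by
  rw [expect, tsum_eq_sum (s := s) fun b hb => by
    rw [PMF.uniformOfFinset_apply_of_notMem _ hb, zero_mul], ENNReal.div_eq_inv_mul, Finset.mul_sum]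
  exact Finset.sum_congr rfl fun a ha => by rw [PMF.uniformOfFinset_apply_of_mem _ ha]

theorem expect_mono {p : PMF α} {h h' : α → ℝ≥0∞} (H : ∀ a ∈ p.support, h a ≤ h' a) :
    expect p h ≤ expect p h' := by
  refine ENNReal.tsum_le_tsum fun a => ?_
  by_cases ha : p a = 0
  · simp [ha]
  · exact mul_le_mul_right (H a ((PMF.mem_support_iff _ _).2 ha)) _

theorem expect_congr {p : PMF α} {h h' : α → ℝ≥0∞} (H : ∀ a ∈ p.support, h a = h' a) :
    expect p h = expect p h' :=
  le_antisymm (expect_mono fun a ha => (H a ha).le) (expect_mono fun a ha => (H a ha).ge)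

theorem expect_add (p : PMF α) (h h' : α → ℝ≥0∞) :
    expect p (fun a => h a + h' a) = expect p h + expect p h' := by
  simp_rw [expect, mul_add]
  exact ENNReal.tsum_add

theorem expect_const_mul (p : PMF α) (c : ℝ≥0∞) (h : α → ℝ≥0∞) :
    expect p (fun a => c * h a) = c * expect p h := by
  simp_rw [expect, ← ENNReal.tsum_mul_left, mul_left_comm]

theorem expect_one (p : PMF α) : expect p (fun _ => 1) = 1 := by
  simp [expect, p.tsum_coe]

theorem expect_sum {ι : Type*} (p : PMF α) (s : Finset ι) (h : ι → α → ℝ≥0∞) :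
    expect p (fun a => ∑ i ∈ s, h i a) = ∑ i ∈ s, expect p (h i) := by
  simp_rw [expect, Finset.mul_sum]
  exact Summable.tsum_finsetSum fun _ _ => ENNReal.summable

theorem toOuterMeasure_eq_expect (p : PMF α) (s : Set α) :
    p.toOuterMeasure s = expect p (s.indicator 1) := by
  rw [PMF.toOuterMeasure_apply, expect]
  refine tsum_congr fun a => ?_
  by_cases ha : a ∈ s <;> simp [ha]

/-- The law after `t` steps of the Markov chain with transition kernel `κ`, started at `a`. -/
def chain (κ : α → PMF α) (a : α) : ℕ → PMF α
  | 0 => PMF.pure a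
  | t + 1 => (chain κ a t).bind κ

variable {κ : α → PMF α} {a₀ : α} {I : α → Prop}

theorem chain_invariant (h0 : I a₀) (hI : ∀ a, I a → ∀ b ∈ (κ a).support, I b) (t : ℕ) :
    ∀ a ∈ (chain κ a₀ t).support, I a := by
  induction t with
  | zero =>
    intro a ha
    rw [chain, PMF.support_pure, Set.mem_singleton_iff] at ha
    rwa [ha]
  | succ t ih =>
    intro b hb
    rw [chain, PMF.mem_support_bind_iff] at hb
    obtain ⟨a, ha, hab⟩ := hb
    exact hI a (ih a ha) b hab

theorem expect_chain_of_harmonic (h0 : I a₀) (hI : ∀ a, I a → ∀ b ∈ (κ a).support, I b)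
    {h : α → ℝ≥0∞} (hh : ∀ a, I a → expect (κ a) h = h a) (t : ℕ) :
    expect (chain κ a₀ t) h = h a₀ := by
  induction t with
  | zero => rw [chain, expect_pure]
  | succ t ih =>
    rw [chain, expect_bind, ← ih]
    exact expect_congr fun a ha => hh a (chain_invariant h0 hI t a ha)

theorem tsum_expect_chain_le_of_potential (h0 : I a₀)
    (hI : ∀ a, I a → ∀ b ∈ (κ a).support, I b)
    {h g : α → ℝ≥0∞} (hh : ∀ a, I a → g a + expect (κ a) h ≤ h a) :
    ∑' t, expect (chain κ a₀ t) g ≤ h a₀ := by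
  have partial_sum (N : ℕ) :
      ∑ t ∈ Finset.range N, expect (chain κ a₀ t) g + expect (chain κ a₀ N) h ≤ h a₀ := by
    induction N with
    | zero => simp [chain, expect_pure]
    | succ N ih =>
      refine le_trans ?_ ih
      rw [Finset.sum_range_succ, add_assoc, chain, expect_bind, ← expect_add]
      gcongr
      exact expect_mono fun a ha => hh a (chain_invariant h0 hI N a ha)
  exact ENNReal.tsum_le_of_sum_range_le fun N => le_self_add.trans (partial_sum N)

theorem chain_le_of_harmonic (h0 : I a₀) (hI : ∀ a, I a → ∀ b ∈ (κ a).support, I b)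
    {h : α → ℝ≥0∞} (hh : ∀ a, I a → expect (κ a) h = h a) {A : Set α}
    (hA : ∀ a ∈ A, I a → 1 ≤ h a) (t : ℕ) :
    (chain κ a₀ t).toOuterMeasure A ≤ h a₀ := by
  rw [← expect_chain_of_harmonic h0 hI hh t, toOuterMeasure_eq_expect]
  refine expect_mono fun a ha => ?_
  by_cases haA : a ∈ A
  · simpa [haA] using hA a haA (chain_invariant h0 hI t a ha)
  · simp [haA]

theorem le_chain_add_of_harmonic (h0 : I a₀) (hI : ∀ a, I a → ∀ b ∈ (κ a).support, I b)
    {h : α → ℝ≥0∞} (hh : ∀ a, I a → expect (κ a) h = h a) {A D : Set α}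
    (hA : ∀ a ∈ D, I a → h a ≤ A.indicator 1 a) {B : ℝ≥0∞} (hhB : ∀ a, I a → h a ≤ B) (t : ℕ) :
    h a₀ ≤ (chain κ a₀ t).toOuterMeasure A + B * (chain κ a₀ t).toOuterMeasure Dᶜ := by
  rw [← expect_chain_of_harmonic h0 hI hh t, toOuterMeasure_eq_expect,
    toOuterMeasure_eq_expect, ← expect_const_mul, ← expect_add]
  refine expect_mono fun a ha => ?_
  have hIa := chain_invariant h0 hI t a ha
  by_cases haD : a ∈ D
  · exact (hA a haD hIa).trans le_self_add
  · simpa [haD] using (hhB a hIa).trans le_add_self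

/-- `D` need not be absorbing: all that matters is that the time spent outside `D` has finite
expectation, so that the mass outside `D` tends to zero. -/
theorem iSup_chain_eq_of_harmonic (h0 : I a₀) (hI : ∀ a, I a → ∀ b ∈ (κ a).support, I b)
    {h : α → ℝ≥0∞} (hh : ∀ a, I a → expect (κ a) h = h a) {A D : Set α} (hAD : A ⊆ D)
    (hA : ∀ a ∈ D, I a → h a = A.indicator 1 a) {B : ℝ≥0∞} (hB : B ≠ ∞)
    (hhB : ∀ a, I a → h a ≤ B)
    (hD : ∑' t, (chain κ a₀ t).toOuterMeasure Dᶜ ≠ ∞) :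
    ⨆ t, (chain κ a₀ t).toOuterMeasure A = h a₀ := by
  set P := ⨆ t, (chain κ a₀ t).toOuterMeasure A
  apply le_antisymm
  · exact iSup_le <| chain_le_of_harmonic h0 hI hh fun a ha hIa => by
      simp [hA a (hAD ha) hIa, ha]
  · have vanish : Filter.Tendsto (fun t => P + B * (chain κ a₀ t).toOuterMeasure Dᶜ)
        Filter.atTop (nhds P) := by
      simpa using tendsto_const_nhds.add
        (ENNReal.Tendsto.const_mul (ENNReal.tendsto_atTop_zero_of_tsum_ne_top hD) (Or.inr hB))
    refine ge_of_tendsto' vanish fun t => ?_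
    refine (le_chain_add_of_harmonic h0 hI hh (fun a ha hIa => (hA a ha hIa).le) hhB t).trans ?_
    gcongr
    exact le_iSup (fun t => (chain κ a₀ t).toOuterMeasure A) t

theorem chain_monotone_of_absorbing {A : Set α} (hA : ∀ a ∈ A, κ a = PMF.pure a) :
    Monotone fun t => (chain κ a₀ t).toOuterMeasure A := by
  refine monotone_nat_of_le_succ fun t => ?_
  rw [toOuterMeasure_eq_expect, toOuterMeasure_eq_expect, chain, expect_bind]
  refine expect_mono fun a _ => ?_
  by_cases ha : a ∈ A
  · rw [hA a ha, expect_pure]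
  · simp [ha]

end Markov

section Draw

variable {n : ℕ} {α : Type}

theorem expect_draw {s : Finset α} (hs : s.Nonempty) (f : α → Config n) (c : Config n)
    (h : Config n → ℝ≥0∞) :
    expect (draw s f c) h = (∑ a ∈ s, h (f a)) / (s.card : ℝ≥0∞) := by
  rw [draw, dif_pos hs, expect_map, expect_uniformOfFinset, Function.comp_def]

theorem draw_empty (f : α → Config n) (c : Config n) : draw ∅ f c = PMF.pure c := by
  rw [draw, dif_neg Finset.not_nonempty_empty]

theorem exists_of_mem_support_draw {s : Finset α} (hs : s.Nonempty) {f : α → Config n}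
    {c b : Config n} (hb : b ∈ (draw s f c).support) : ∃ a ∈ s, b = f a := by
  rw [draw, dif_pos hs, PMF.mem_support_map_iff] at hb
  obtain ⟨a, ha, rfl⟩ := hb
  exact ⟨a, by simpa using ha, rfl⟩

theorem expect_draw_ofReal {s : Finset α} (hs : s.Nonempty) {f : α → Config n} {c : Config n}
    {h : Config n → ℝ} (h0 : ∀ a ∈ s, 0 ≤ h (f a)) :
    expect (draw s f c) (fun c => ENNReal.ofReal (h c)) =
      ENNReal.ofReal ((∑ a ∈ s, h (f a)) / s.card) := by
  rw [expect_draw hs, ← ENNReal.ofReal_sum_of_nonneg h0, ← ENNReal.ofReal_natCast,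
    ← ENNReal.ofReal_div_of_pos (by exact_mod_cast hs.card_pos)]

end Draw

/-! ## Trees given by lists of edges -/

section Graphs

variable {V : Type*}

/-- The graph whose edges are listed in `E`; pairs `(a, a)` are ignored. -/
def edgeGraph (E : List (V × V)) : SimpleGraph V :=
  SimpleGraph.fromEdgeSet {e | ∃ p ∈ E, e = s(p.1, p.2)}

theorem edgeGraph_adj {E : List (V × V)} {a b : V} :
    (edgeGraph E).Adj a b ↔ ((a, b) ∈ E ∨ (b, a) ∈ E) ∧ a ≠ b := by
  simp only [edgeGraph, SimpleGraph.fromEdgeSet_adj, Set.mem_ofPred_eq, Sym2.eq_iff, Prod.exists]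
  refine and_congr_left fun _ => ⟨?_, ?_⟩
  · rintro ⟨x, y, h, ⟨rfl, rfl⟩ | ⟨rfl, rfl⟩⟩
    · exact Or.inl h
    · exact Or.inr h
  · rintro (h | h)
    · exact ⟨a, b, h, Or.inl ⟨rfl, rfl⟩⟩
    · exact ⟨b, a, h, Or.inr ⟨rfl, rfl⟩⟩

theorem edgeGraph_mono {E E' : List (V × V)} (h : E ⊆ E') : edgeGraph E ≤ edgeGraph E' := by
  intro a b hab
  rw [edgeGraph_adj] at hab ⊢
  exact ⟨hab.1.imp (@h _) (@h _), hab.2⟩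

theorem edgeGraph_congr {E E' : List (V × V)} (h : ∀ e, e ∈ E ↔ e ∈ E') :
    edgeGraph E = edgeGraph E' :=
  le_antisymm (edgeGraph_mono fun e => (h e).1) (edgeGraph_mono fun e => (h e).2)

theorem edgeGraph_le_iff {E : List (V × V)} {T : SimpleGraph V} (hE : ∀ e ∈ E, e.1 ≠ e.2) :
    edgeGraph E ≤ T ↔ ∀ e ∈ E, T.Adj e.1 e.2 := by
  refine ⟨fun h e he => h (edgeGraph_adj.2 ⟨Or.inl he, hE e he⟩), fun h a b hab => ?_⟩
  rcases (edgeGraph_adj.1 hab).1 with hab | hba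
  · exact h _ hab
  · exact (h _ hba).symm

theorem edgeGraph_map_eq_comap (π : Equiv.Perm V) (E : List (V × V)) :
    edgeGraph (E.map (Prod.map π π)) = (edgeGraph E).comap π.symm := by
  have mem_map (a b : V) : (a, b) ∈ E.map (Prod.map π π) ↔ (π.symm a, π.symm b) ∈ E := by
    simp only [List.mem_map, Prod.exists, Prod.map_apply, Prod.mk.injEq, ← Equiv.eq_symm_apply]
    exact ⟨fun ⟨_, _, h, hx, hy⟩ => hx ▸ hy ▸ h, fun h => ⟨_, _, h, rfl, rfl⟩⟩
  ext a b
  simp [edgeGraph_adj, mem_map]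

theorem ncard_edgeSet_edgeGraph_le (E : List (V × V)) :
    (edgeGraph E).edgeSet.ncard ≤ E.length := by
  classical
  have hsub : (edgeGraph E).edgeSet ⊆ ((E.map fun e => s(e.1, e.2)).toFinset : Set (Sym2 V)) := by
    intro e he
    rw [edgeGraph, SimpleGraph.edgeSet_fromEdgeSet] at he
    obtain ⟨⟨p, hp, rfl⟩, _⟩ := he
    simp only [List.coe_toFinset, List.mem_map, Set.mem_ofPred_eq]
    exact ⟨p, hp, rfl⟩
  calc (edgeGraph E).edgeSet.ncard
      ≤ (E.map fun e => s(e.1, e.2)).toFinset.card := by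
        rw [← Set.ncard_coe_finset]
        exact Set.ncard_le_ncard hsub (Finset.finite_toSet _)
    _ ≤ E.length := by simpa using List.toFinset_card_le (E.map fun e => s(e.1, e.2))

/-- The list `E` consists of the edges of a tree with vertex set `S`, each of them once. Acyclicity
is encoded by the number of edges. -/
structure SpansTree (E : List (V × V)) (S : Finset V) : Prop where
  nonempty : S.Nonempty
  mem : ∀ e ∈ E, e.1 ∈ S ∧ e.2 ∈ S
  ne : ∀ e ∈ E, e.1 ≠ e.2
  reachable : ∀ a ∈ S, ∀ b ∈ S, (edgeGraph E).Reachable a b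
  length : E.length + 1 = S.card

theorem SpansTree.cons [DecidableEq V] {E : List (V × V)} {S : Finset V} (h : SpansTree E S)
    {u w : V} (hu : u ∈ S) (hw : w ∉ S) : SpansTree ((w, u) :: E) (insert w S) := by
  have hwu : w ≠ u := fun h => hw (h ▸ hu)
  have adj : (edgeGraph ((w, u) :: E)).Adj w u :=
    edgeGraph_adj.2 ⟨Or.inl List.mem_cons_self, hwu⟩
  have reachable_u : ∀ a ∈ insert w S, (edgeGraph ((w, u) :: E)).Reachable a u := by
    intro a ha
    rcases Finset.mem_insert.1 ha with rfl | ha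
    · exact adj.reachable
    · exact (h.reachable a ha u hu).mono (edgeGraph_mono (List.subset_cons_self _ _))
  refine ⟨Finset.insert_nonempty _ _, ?_, ?_,
    fun a ha b hb => (reachable_u a ha).trans (reachable_u b hb).symm, ?_⟩
  · simpa [hu] using fun a b hab => (h.mem (a, b) hab).imp Or.inr Or.inr
  · simpa [hwu] using fun a b hab => h.ne (a, b) hab
  · rw [Finset.card_insert_of_notMem hw, List.length_cons, h.length]

theorem SpansTree.isTree_edgeGraph [Fintype V] {E : List (V × V)}
    (h : SpansTree E Finset.univ) : (edgeGraph E).IsTree := by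
  have connected : (edgeGraph E).Connected :=
    { preconnected := fun a b => h.reachable a (Finset.mem_univ a) b (Finset.mem_univ b)
      nonempty := Finset.univ_nonempty_iff.1 h.nonempty }
  refine SimpleGraph.isTree_iff_connected_and_card.2
    ⟨connected, le_antisymm ?_ connected.card_vert_le_card_edgeSet_add_one⟩
  rw [Nat.card_eq_fintype_card (α := V), ← Finset.card_univ, ← h.length]
  exact Nat.succ_le_succ (ncard_edgeSet_edgeGraph_le E)

theorem eq_of_le_of_isTree {G T : SimpleGraph V} (hG : G.IsTree) (hT : T.IsTree) (h : G ≤ T) :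
    G = T :=
  ((SimpleGraph.isTree_iff_minimal_connected.1 hT).eq_of_ge hG.1 h).symm

/-- `p` maps every vertex of `T` other than the root `r` to the next vertex on the way to `r`; the
last field says that iterating `p` leads to `r`. -/
structure ParentMap (T : SimpleGraph V) (r : V) (p : V → V) : Prop where
  root : p r = r
  adj_iff : ∀ a b, T.Adj a b ↔ (a ≠ r ∧ p a = b) ∨ (b ≠ r ∧ p b = a)
  rank : ∃ d : V → ℕ, ∀ v, v ≠ r → d (p v) < d v

theorem exists_parentMap {T : SimpleGraph V} (hT : T.IsTree) (r : V) : ∃ p, ParentMap T r p := by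
  classical
  choose P isPath unique using fun v => hT.existsUnique_path v r
  have path_root : P r = .nil := (unique r _ .nil).symm
  have path_snd (v : V) : P (P v).snd = (P v).tail := (unique _ _ (isPath v).tail).symm
  have snd_or_snd (a b : V) (hab : T.Adj a b) : (P a).snd = b ∨ (b ≠ r ∧ (P b).snd = a) := by
    by_cases hb : b ∈ (P a).support
    · exact Or.inl (hT.2.eq_snd_of_adj_start (isPath a) hab hb).symm
    · refine Or.inr ⟨fun h => hb (h ▸ (P a).end_mem_support), ?_⟩
      rw [← unique b _ ((isPath a).cons (h := hab.symm) hb), SimpleGraph.Walk.snd_cons]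
  have adj_snd (v : V) (hv : v ≠ r) : T.Adj v (P v).snd :=
    (P v).adj_snd (SimpleGraph.Walk.not_nil_of_ne hv)
  refine ⟨fun v => (P v).snd, ?_, fun a b => ⟨fun hab => ?_, ?_⟩, fun v => (P v).length, ?_⟩
  · simp [path_root]
  · rcases snd_or_snd a b hab with h | h
    · refine Or.inl ⟨?_, h⟩
      rintro rfl
      exact hab.ne (by simpa [path_root] using h)
    · exact Or.inr h
  · rintro (⟨ha, rfl⟩ | ⟨hb, rfl⟩)
    · exact adj_snd a ha
    · exact (adj_snd b hb).symm
  · intro v hv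
    have := SimpleGraph.Walk.length_tail_add_one (p := P v) (SimpleGraph.Walk.not_nil_of_ne hv)
    simp only [path_snd v]
    omega

section Parent

variable {T : SimpleGraph V} {r : V} {p : V → V} {E : List (V × V)} {S : Finset V}

/-- Some edge of `E` leads out of the set of descendants of `v`, and the only edge of `T` that does
so joins `v` to its parent. -/
theorem SpansTree.parent_mem (h : SpansTree E S) (hp : ParentMap T r p)
    (hE : ∀ e ∈ E, T.Adj e.1 e.2) (hr : r ∈ S) {v : V} (hv : v ∈ S) : p v ∈ S := by
  by_cases hvr : v = r
  · rwa [hvr, hp.root]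
  obtain ⟨w⟩ := h.reachable v hv r hr
  have root_notMem : r ∉ {x | ∃ k, p^[k] x = v} := fun ⟨k, hk⟩ =>
    hvr (by rw [← hk, Function.iterate_fixed hp.root])
  obtain ⟨d, -, ⟨k, hk⟩, hd⟩ := w.exists_boundary_dart {x | ∃ k, p^[k] x = v} ⟨0, rfl⟩ root_notMem
  have mem_and_adj : d.snd ∈ S ∧ T.Adj d.fst d.snd := by
    rcases (edgeGraph_adj.1 d.adj).1 with he | he
    · exact ⟨(h.mem _ he).2, hE _ he⟩
    · exact ⟨(h.mem _ he).1, (hE _ he).symm⟩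
  rcases (hp.adj_iff _ _).1 mem_and_adj.2 with ⟨_, hfst⟩ | ⟨_, hsnd⟩
  · cases k with
    | zero =>
      have fst_eq : d.fst = v := hk
      rw [← fst_eq, hfst]
      exact mem_and_adj.1
    | succ k =>
      rw [Function.iterate_succ_apply, hfst] at hk
      exact absurd ⟨k, hk⟩ hd
  · refine absurd ⟨k + 1, ?_⟩ hd
    rw [Function.iterate_succ_apply, hsnd, hk]

theorem SpansTree.adj_iff_parent_eq (h : SpansTree E S) (hp : ParentMap T r p)
    (hE : ∀ e ∈ E, T.Adj e.1 e.2) (hr : r ∈ S) {u v : V} (hu : u ∈ S) (hv : v ∉ S) :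
    T.Adj v u ↔ p v = u := by
  rw [hp.adj_iff]
  refine ⟨?_, fun hpv => Or.inl ⟨fun hvr => hv (hvr ▸ hr), hpv⟩⟩
  rintro (⟨-, hpv⟩ | ⟨-, hpu⟩)
  · exact hpv
  · exact absurd (hpu ▸ h.parent_mem hp hE hr hu) hv

end Parent

end Graphs

/-! ## The invariant -/

/-- The list `path` has no repetitions and avoids `K`, and `mark` is its indicator function. In the
algorithm `K` is the vertex set of the tree and `path` is the loop-erased walk. -/
structure MarkedPath {V : Type*} (K : Finset V) (path : List V) (mark : V → Bool) : Prop where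
  nodup : path.Nodup
  notMem : ∀ v ∈ path, v ∉ K
  mark_iff : ∀ v, mark v = true ↔ v ∈ path

namespace MarkedPath

variable {V : Type*} {K : Finset V} {path rest : List V} {mark : V → Bool} {u v : V}

theorem nil (h : ∀ v, mark v = false) : MarkedPath K [] mark :=
  ⟨List.nodup_nil, by simp, by simp [h]⟩

theorem head_notMem (h : MarkedPath K (v :: rest) mark) : v ∉ K :=
  h.notMem v List.mem_cons_self

theorem ne_head (h : MarkedPath K (v :: rest) mark) (hu : u ∈ rest) : v ≠ u := fun hvu =>
  (List.nodup_cons.1 h.nodup).1 (hvu ▸ hu)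

theorem disjoint [DecidableEq V] (h : MarkedPath K path mark) : Disjoint K path.toFinset :=
  Finset.disjoint_right.2 fun u hu => h.notMem u (List.mem_toFinset.1 hu)

theorem card_add_length_le [Fintype V] (h : MarkedPath K path mark) :
    K.card + path.length ≤ Fintype.card V := by
  classical
  rw [← List.toFinset_card_of_nodup h.nodup, ← Finset.card_union_of_disjoint h.disjoint]
  exact Finset.card_le_univ _

variable [DecidableEq V]

theorem cons (h : MarkedPath K path mark) (hK : u ∉ K) (hu : u ∉ path) :
    MarkedPath K (u :: path) (Function.update mark u true) where
  nodup := List.nodup_cons.2 ⟨hu, h.nodup⟩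
  notMem := List.forall_mem_cons.2 ⟨hK, h.notMem⟩
  mark_iff w := by
    by_cases hw : w = u
    · simp [hw]
    · simp [hw, h.mark_iff]

theorem tail (h : MarkedPath K (v :: rest) mark) :
    MarkedPath K rest (Function.update mark v false) where
  nodup := (List.nodup_cons.1 h.nodup).2
  notMem := (List.forall_mem_cons.1 h.notMem).2
  mark_iff w := by
    by_cases hw : w = v
    · simpa [hw] using (List.nodup_cons.1 h.nodup).1
    · simp [hw, h.mark_iff]

theorem tail_insert (h : MarkedPath K (v :: rest) mark) :
    MarkedPath (insert v K) rest (Function.update mark v false) where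
  nodup := h.tail.nodup
  notMem w hw := by
    simpa [(h.ne_head hw).symm] using h.tail.notMem w hw
  mark_iff := h.tail.mark_iff

end MarkedPath

variable {n : ℕ}

/-- The set `V_X` in a memory with the given values of `slot` and `free`. -/
def treeSet (slot : Equiv.Perm (Fin n)) (free : Fin (n + 1)) : Finset (Fin n) :=
  Finset.univ.filter fun v => (free : ℕ) ≤ (slot.symm v : ℕ)

theorem mem_treeSet {slot : Equiv.Perm (Fin n)} {free : Fin (n + 1)} {v : Fin n} :
    v ∈ treeSet slot free ↔ (free : ℕ) ≤ (slot.symm v : ℕ) := by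
  simp [treeSet]

theorem treeSet_last (slot : Equiv.Perm (Fin n)) : treeSet slot (Fin.last n) = ∅ := by
  simp [treeSet]

theorem treeSet_eq_univ {slot : Equiv.Perm (Fin n)} {free : Fin (n + 1)} (h : (free : ℕ) = 0) :
    treeSet slot free = Finset.univ := by
  simp [treeSet, h]

theorem slot_notMem_treeSet {slot : Equiv.Perm (Fin n)} {free : Fin (n + 1)} {i : Fin n}
    (hi : (i : ℕ) < free) : slot i ∉ treeSet slot free := by
  simpa [treeSet] using hi

section AddVertex

variable (c : Config n) (v : Fin n)

@[simp] theorem addVertex_phase : (c.addVertex v).phase = c.phase := by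
  unfold Config.addVertex; split_ifs <;> rfl
@[simp] theorem addVertex_inE : (c.addVertex v).inE = c.inE := by
  unfold Config.addVertex; split_ifs <;> rfl
@[simp] theorem addVertex_edges : (c.addVertex v).edges = c.edges := by
  unfold Config.addVertex; split_ifs <;> rfl
@[simp] theorem addVertex_path : (c.addVertex v).path = c.path := by
  unfold Config.addVertex; split_ifs <;> rfl
@[simp] theorem addVertex_mark : (c.addVertex v).mark = c.mark := by
  unfold Config.addVertex; split_ifs <;> rfl
@[simp] theorem addVertex_label : (c.addVertex v).label = c.label := by
  unfold Config.addVertex; split_ifs <;> rfl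
@[simp] theorem addVertex_out : (c.addVertex v).out = c.out := by
  unfold Config.addVertex; split_ifs <;> rfl

variable {c v}

theorem treeSet_addVertex (hv : v ∉ treeSet c.slot c.free) :
    treeSet (c.addVertex v).slot (c.addVertex v).free = insert v (treeSet c.slot c.free) := by
  have h : (c.slot.symm v : ℕ) < c.free := by simpa [treeSet] using hv
  ext w
  have eq_iff : w = v ↔ c.slot.symm w = c.slot.symm v := c.slot.symm.injective.eq_iff.symm
  rw [Finset.mem_insert, mem_treeSet, mem_treeSet, Config.addVertex, dif_pos h, eq_iff]
  simp only [Equiv.Perm.mul_def, Equiv.symm_trans_apply, Equiv.symm_swap, Equiv.swap_apply_def]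
  have := c.free.isLt
  grind

end AddVertex

/-- The lists `vs` and `es` of vertices and edges describe a tree; this is the precondition on the
input of the algorithm. -/
structure TreeInput (vs : List (Fin n)) (es : List (Fin n × Fin n)) : Prop where
  nodup : vs.Nodup
  spans : SpansTree es vs.toFinset

/-- The part of the memory that is used by the walk, the shuffle and the output has not been
touched. -/
def Fresh (c : Config n) : Prop :=
  c.path = [] ∧ (∀ v, c.mark v = false) ∧ c.label = 1 ∧ c.out = []

/-- The memory while the tree grows: `V_X` contains the initial vertices `vs`, the path is a marked
path outside `V_X`, and the recorded edges span `S`. The set `S` is `V_X`, except that during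
attachment the head of the path is already joined to the tree by an edge. -/
def Growing (vs : List (Fin n)) (c : Config n) (S : Finset (Fin n)) : Prop :=
  c.label = 1 ∧ c.out = [] ∧ vs.toFinset ⊆ treeSet c.slot c.free ∧
    MarkedPath (treeSet c.slot c.free) c.path c.mark ∧ SpansTree c.edges S

/-- The set `K` together with the head of the list, if there is one. -/
def headSet {V : Type*} [DecidableEq V] (K : Finset V) : List V → Finset V
  | [] => K
  | v :: _ => insert v K

/-- The invariant of the algorithm on the input `vs`, `es`. -/
def Inv (vs : List (Fin n)) (es : List (Fin n × Fin n)) (c : Config n) : Prop :=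
  match c.phase with
  | .init _ => Fresh c ∧ c.inV = vs ∧ c.inE = es ∧ c.edges = [] ∧ treeSet c.slot c.free = ∅
  | .loadVertices => Fresh c ∧ c.inE = es ∧ c.edges = [] ∧
      ∃ pre, pre ++ c.inV = vs ∧ treeSet c.slot c.free = pre.toFinset
  | .loadEdges => Fresh c ∧ c.edges.reverse ++ c.inE = es ∧ treeSet c.slot c.free = vs.toFinset
  | .choose => c.path = [] ∧ Growing vs c (treeSet c.slot c.free)
  | .walk => c.path ≠ [] ∧ Growing vs c (treeSet c.slot c.free)
  | .erase u => u ∈ c.path ∧ Growing vs c (treeSet c.slot c.free)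
  | .attach => Growing vs c (headSet (treeSet c.slot c.free) c.path)
  | .shuffle _ => c.out = [] ∧ SpansTree c.edges Finset.univ
  | .relabel => (edgeGraph (c.edges.map (Prod.map c.label c.label) ++ c.out)).IsTree
  | .done => c.edges = [] ∧ (edgeGraph c.out).IsTree

theorem inv_start {vs : List (Fin n)} {es : List (Fin n × Fin n)} : Inv vs es (start vs es) :=
  ⟨⟨rfl, fun _ => rfl, rfl, rfl⟩, rfl, rfl, rfl, treeSet_last _⟩

/-! ## The steps of the procedure -/

section Steps

variable {n : ℕ} {c b : Config n}

theorem law_eq_chain (vs : List (Fin n)) (es : List (Fin n × Fin n)) (t : ℕ) :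
    law vs es t = chain (step ⊤) (start vs es) t := by
  induction t with
  | zero => rfl
  | succ t ih => rw [law, chain, ih]

/-- The memory after the head `v` of the path has been moved into the tree and the edge to the next
vertex of the path, if there is one, has been recorded. -/
def attachHead (c : Config n) (v : Fin n) (rest : List (Fin n)) : Config n :=
  { c.addVertex v with
    path := rest
    mark := Function.update c.mark v false
    edges := (rest.head?.map fun w => (w, v)).toList ++ c.edges }

/-- `DetStep c b` says that the procedure goes from `c` to `b` without drawing a random element. -/
inductive DetStep (c : Config n) : Config n → Prop
  | init_zero (h : c.phase = .init 0) : DetStep c { c with phase := .loadVertices }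
  | init_succ {k : ℕ} (h : c.phase = .init (k + 1)) : DetStep c { c with phase := .init k }
  | loadVertices_nil (h : c.phase = .loadVertices) (hV : c.inV = []) :
      DetStep c { c with phase := .loadEdges }
  | loadVertices_cons (h : c.phase = .loadVertices) {v : Fin n} {l : List (Fin n)}
      (hV : c.inV = v :: l) : DetStep c { c.addVertex v with inV := l }
  | loadEdges_nil (h : c.phase = .loadEdges) (hE : c.inE = []) :
      DetStep c { c with phase := .choose }
  | loadEdges_cons (h : c.phase = .loadEdges) {e : Fin n × Fin n} {l : List (Fin n × Fin n)}
      (hE : c.inE = e :: l) : DetStep c { c with inE := l, edges := e :: c.edges }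
  | choose_none (h : c.phase = .choose) (h0 : (c.free : ℕ) = 0) :
      DetStep c { c with phase := .shuffle (Fin.last n) }
  | erase_self {u : Fin n} (h : c.phase = .erase u) {rest : List (Fin n)}
      (hp : c.path = u :: rest) : DetStep c { c with phase := .walk }
  | erase_ne {u v : Fin n} (h : c.phase = .erase u) {rest : List (Fin n)}
      (hp : c.path = v :: rest) (hvu : v ≠ u) :
      DetStep c { c with path := rest, mark := Function.update c.mark v false }
  | attach_nil (h : c.phase = .attach) (hp : c.path = []) : DetStep c { c with phase := .choose }
  | attach_cons (h : c.phase = .attach) {v : Fin n} {rest : List (Fin n)}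
      (hp : c.path = v :: rest) : DetStep c (attachHead c v rest)
  | shuffle_zero (h : c.phase = .shuffle 0) : DetStep c { c with phase := .relabel }
  | relabel_nil (h : c.phase = .relabel) (hE : c.edges = []) : DetStep c { c with phase := .done }
  | relabel_cons (h : c.phase = .relabel) {e : Fin n × Fin n} {l : List (Fin n × Fin n)}
      (hE : c.edges = e :: l) :
      DetStep c { c with edges := l, out := e.map c.label c.label :: c.out }

theorem DetStep.step_eq (h : DetStep c b) : step ⊤ c = PMF.pure b := by
  cases h with
  | init_zero h => simp only [step, h]
  | init_succ h => simp only [step, h]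
  | loadVertices_nil h hV => simp only [step, h, hV]
  | loadVertices_cons h hV => simp only [step, h, hV]
  | loadEdges_nil h hE => simp only [step, h, hE]
  | loadEdges_cons h hE => simp only [step, h, hE]
  | choose_none h h0 => simp only [step, h, h0, Nat.not_lt_zero, Finset.filter_false, draw_empty]
  | erase_self h hp => simp only [step, h, hp, if_true]
  | erase_ne h hp hvu => simp only [step, h, hp, if_neg hvu]
  | attach_nil h hp => simp only [step, h, hp]
  | attach_cons h hp =>
    simp only [step, h, hp, attachHead]
    split <;> simp_all
  | shuffle_zero h => simp [step, h]
  | relabel_nil h hE => simp only [step, h, hE]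
  | relabel_cons h hE => simp only [step, h, hE]; rfl

/-- The memory after the start of a walk at `v`. -/
def startWalk (c : Config n) (v : Fin n) : Config n :=
  { c with phase := .walk, path := [v], mark := Function.update c.mark v true }

/-- The indices of the vertices among which the next starting vertex is chosen. -/
def freeSlots (c : Config n) : Finset (Fin n) :=
  Finset.univ.filter fun i : Fin n => (i : ℕ) < (c.free : ℕ)

theorem mem_freeSlots {i : Fin n} : i ∈ freeSlots c ↔ (i : ℕ) < c.free := by simp [freeSlots]

theorem freeSlots_nonempty (h : (c.free : ℕ) ≠ 0) : (freeSlots c).Nonempty :=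
  ⟨⟨0, by omega⟩, mem_freeSlots.2 (Nat.pos_of_ne_zero h)⟩

theorem step_choose (h : c.phase = .choose) :
    step ⊤ c = draw (freeSlots c) (fun i => startWalk c (c.slot i))
      { c with phase := .shuffle (Fin.last n) } := by
  simp only [step, h]
  rfl

/-- The memory after the walker has moved from `v`, the head of the path, to `u`. -/
def moveTo (c : Config n) (v u : Fin n) : Config n :=
  if u ∈ treeSet c.slot c.free then { c with phase := .attach, edges := (v, u) :: c.edges }
  else if c.mark u then { c with phase := .erase u }
  else { c with path := u :: c.path, mark := Function.update c.mark u true }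

theorem step_walk (h : c.phase = .walk) {v : Fin n} {rest : List (Fin n)}
    (hp : c.path = v :: rest) :
    step ⊤ c = draw (Finset.univ.erase v) (moveTo c v) c := by
  have neighbors : (⊤ : SimpleGraph (Fin n)).neighborFinset v = Finset.univ.erase v := by
    ext u
    simp [eq_comm]
  simp only [step, h, hp, neighbors, Config.inTree, ← mem_treeSet]
  congr 1
  funext u
  simp only [moveTo, hp, h]

/-- The memory after the transposition of the cells `i` and `j` in the shuffle. -/
def shuffleTo (c : Config n) (i : Fin n) (j : Fin n) : Config n :=
  { c with
    phase := .shuffle i.castSucc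
    label := c.label * Equiv.swap i j }

theorem step_shuffle {i : Fin n} (h : c.phase = .shuffle i.succ) :
    step ⊤ c = draw (Finset.Iic i) (shuffleTo c i) c := by
  simp only [step, h, Fin.val_succ, Nat.succ_pos, dif_pos]
  rfl

theorem step_done (h : c.phase = .done) : step ⊤ c = PMF.pure c := by
  simp only [step, h]

/-- The possibilities for the next step of a memory that satisfies the invariant. -/
inductive StepCase (c : Config n) : Prop
  | det {b : Config n} (hs : DetStep c b)
  | choose (h : c.phase = .choose) (h0 : (c.free : ℕ) ≠ 0)
  | walk (h : c.phase = .walk) {v : Fin n} {rest : List (Fin n)} (hp : c.path = v :: rest)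
  | shuffle {i : Fin n} (h : c.phase = .shuffle i.succ)
  | done (h : c.phase = .done)

theorem Inv.stepCase {vs : List (Fin n)} {es : List (Fin n × Fin n)} (hI : Inv vs es c) :
    StepCase c := by
  cases h : c.phase with
  | init k => cases k with
    | zero => exact .det (.init_zero h)
    | succ k => exact .det (.init_succ h)
  | loadVertices => cases hV : c.inV with
    | nil => exact .det (.loadVertices_nil h hV)
    | cons v l => exact .det (.loadVertices_cons h hV)
  | loadEdges => cases hE : c.inE with
    | nil => exact .det (.loadEdges_nil h hE)
    | cons e l => exact .det (.loadEdges_cons h hE)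
  | choose =>
    by_cases h0 : (c.free : ℕ) = 0
    · exact .det (.choose_none h h0)
    · exact .choose h h0
  | walk =>
    simp only [Inv, h] at hI
    obtain ⟨v, rest, hp⟩ := List.exists_cons_of_ne_nil hI.1
    exact .walk h hp
  | erase u =>
    simp only [Inv, h] at hI
    obtain ⟨v, rest, hp⟩ := List.exists_cons_of_ne_nil (List.ne_nil_of_mem hI.1)
    by_cases hvu : v = u
    · exact .det (.erase_self h (hvu ▸ hp))
    · exact .det (.erase_ne h hp hvu)
  | attach => cases hp : c.path with
    | nil => exact .det (.attach_nil h hp)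
    | cons v rest => exact .det (.attach_cons h hp)
  | shuffle k => cases k using Fin.cases with
    | zero => exact .det (.shuffle_zero h)
    | succ i => exact .shuffle h
  | relabel => cases hE : c.edges with
    | nil => exact .det (.relabel_nil h hE)
    | cons e l => exact .det (.relabel_cons h hE)
  | done => exact .done h

end Steps

/-! ## Preservation of the invariant -/

section Preservation

variable {n : ℕ} {vs : List (Fin n)} {es : List (Fin n × Fin n)} {c b : Config n}

theorem Inv.walk_growing (hI : Inv vs es c) (h : c.phase = .walk) :
    Growing vs c (treeSet c.slot c.free) := by
  simp only [Inv, h] at hI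
  exact hI.2

theorem Inv.attach_growing (hI : Inv vs es c) (h : c.phase = .attach) {v : Fin n}
    {rest : List (Fin n)} (hp : c.path = v :: rest) :
    Growing vs c (insert v (treeSet c.slot c.free)) := by
  simp only [Inv, h, hp, headSet] at hI
  exact hI

theorem Growing.markedPath {S : Finset (Fin n)} (hg : Growing vs c S) {l : List (Fin n)}
    (hp : c.path = l) : MarkedPath (treeSet c.slot c.free) l c.mark :=
  hp ▸ hg.2.2.2.1

theorem Growing.spansTree {S : Finset (Fin n)} (hg : Growing vs c S) : SpansTree c.edges S :=
  hg.2.2.2.2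

theorem moves_nonempty (hin : TreeInput vs es) {S : Finset (Fin n)} (hg : Growing vs c S)
    {v : Fin n} {rest : List (Fin n)} (hp : c.path = v :: rest) :
    (Finset.univ.erase v : Finset (Fin n)).Nonempty := by
  obtain ⟨r, hr⟩ := hin.spans.nonempty
  refine ⟨r, Finset.mem_erase.2 ⟨?_, Finset.mem_univ r⟩⟩
  rintro rfl
  exact (hg.markedPath hp).head_notMem (hg.2.2.1 hr)

theorem notMem_of_loadVertices (hin : TreeInput vs es) (hI : Inv vs es c)
    (h : c.phase = .loadVertices) {v : Fin n} {l : List (Fin n)} (hV : c.inV = v :: l) :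
    v ∉ treeSet c.slot c.free := by
  simp only [Inv, h] at hI
  obtain ⟨-, -, -, pre, hpre, hK⟩ := hI
  have disjoint : List.Disjoint pre (v :: l) :=
    List.disjoint_of_nodup_append (by rw [← hV, hpre]; exact hin.nodup)
  rw [hK, List.mem_toFinset]
  exact fun hv => disjoint hv List.mem_cons_self

theorem inv_loadVertices_cons (hin : TreeInput vs es) (hI : Inv vs es c)
    (h : c.phase = .loadVertices) {v : Fin n} {l : List (Fin n)} (hV : c.inV = v :: l) :
    Inv vs es { c.addVertex v with inV := l } := by
  have hv := notMem_of_loadVertices hin hI h hV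
  simp only [Inv, h, Fresh, addVertex_phase, addVertex_path, addVertex_mark, addVertex_label,
    addVertex_out, addVertex_inE, addVertex_edges, treeSet_addVertex hv] at hI ⊢
  obtain ⟨hfresh, hE, hedges, pre, hpre, hK⟩ := hI
  refine ⟨hfresh, hE, hedges, pre ++ [v], by simpa [hV] using hpre, ?_⟩
  rw [hK, List.toFinset_append, Finset.union_comm]
  rfl

theorem spansTree_of_loadEdges (hin : TreeInput vs es) (hI : Inv vs es c)
    (h : c.phase = .loadEdges) (hE : c.inE = []) : SpansTree c.edges (treeSet c.slot c.free) := by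
  simp only [Inv, h, hE, List.append_nil] at hI
  obtain ⟨-, rfl, hK⟩ := hI
  have same_graph : edgeGraph c.edges.reverse = edgeGraph c.edges :=
    edgeGraph_congr fun e => List.mem_reverse
  rw [hK]
  exact
    { nonempty := hin.spans.nonempty
      mem := fun e he => hin.spans.mem e (List.mem_reverse.2 he)
      ne := fun e he => hin.spans.ne e (List.mem_reverse.2 he)
      reachable := same_graph ▸ hin.spans.reachable
      length := by rw [← hin.spans.length, List.length_reverse] }

theorem inv_choose_of_loadEdges (hin : TreeInput vs es) (hI : Inv vs es c)
    (h : c.phase = .loadEdges) (hE : c.inE = []) : Inv vs es { c with phase := .choose } := by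
  have hspan := spansTree_of_loadEdges hin hI h hE
  simp only [Inv, h] at hI
  obtain ⟨⟨hp, hmark, hlabel, hout⟩, -, hK⟩ := hI
  exact ⟨hp, hlabel, hout, hK.ge, hp ▸ .nil hmark, hspan⟩

theorem inv_startWalk (hI : Inv vs es c) (h : c.phase = .choose) {v : Fin n}
    (hv : v ∉ treeSet c.slot c.free) : Inv vs es (startWalk c v) := by
  simp only [Inv, h] at hI
  obtain ⟨hp, hlabel, hout, hvs, hpath, hspan⟩ := hI
  rw [hp] at hpath
  exact ⟨List.cons_ne_nil _ _, hlabel, hout, hvs, hpath.cons hv List.not_mem_nil, hspan⟩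

theorem inv_moveTo (hI : Inv vs es c) (h : c.phase = .walk) {v : Fin n} {rest : List (Fin n)}
    (hp : c.path = v :: rest) (u : Fin n) : Inv vs es (moveTo c v u) := by
  obtain ⟨hlabel, hout, hvs, hpath, hspan⟩ := hI.walk_growing h
  have hv : v ∉ treeSet c.slot c.free := hpath.notMem v (by rw [hp]; exact List.mem_cons_self)
  unfold moveTo
  split_ifs with hK hmark
  · have head_joined : SpansTree ((v, u) :: c.edges) (headSet (treeSet c.slot c.free) c.path) := by
      rw [hp]
      exact hspan.cons hK hv
    exact ⟨hlabel, hout, hvs, hpath, head_joined⟩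
  · exact ⟨(hpath.mark_iff u).1 hmark, hlabel, hout, hvs, hpath, hspan⟩
  · simp only [Inv, h]
    exact ⟨List.cons_ne_nil _ _, hlabel, hout, hvs,
      hpath.cons hK fun hu => hmark ((hpath.mark_iff u).2 hu), hspan⟩

theorem inv_eraseHead (hI : Inv vs es c) {u v : Fin n} (h : c.phase = .erase u)
    {rest : List (Fin n)} (hp : c.path = v :: rest) (hvu : v ≠ u) :
    Inv vs es { c with path := rest, mark := Function.update c.mark v false } := by
  simp only [Inv, h, hp, List.mem_cons, hvu.symm, false_or] at hI ⊢
  obtain ⟨hu, hlabel, hout, hvs, hpath, hspan⟩ := hI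
  rw [hp] at hpath
  exact ⟨hu, hlabel, hout, hvs, hpath.tail, hspan⟩

theorem inv_attachHead (hI : Inv vs es c) (h : c.phase = .attach) {v : Fin n} {rest : List (Fin n)}
    (hp : c.path = v :: rest) : Inv vs es (attachHead c v rest) := by
  have hg := hI.attach_growing h hp
  have hpath := hg.markedPath hp
  obtain ⟨hlabel, hout, hvs, -, hspan⟩ := hg
  simp only [Inv, attachHead, addVertex_phase, h, Growing, addVertex_label, addVertex_out,
    treeSet_addVertex hpath.head_notMem]
  refine ⟨hlabel, hout, hvs.trans (Finset.subset_insert _ _), hpath.tail_insert, ?_⟩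
  cases rest with
  | nil => exact hspan
  | cons w rest =>
    exact hspan.cons (Finset.mem_insert_self _ _) hpath.tail_insert.head_notMem

theorem inv_shuffleTo (hI : Inv vs es c) {k : Fin (n + 1)} (h : c.phase = .shuffle k)
    (i j : Fin n) : Inv vs es (shuffleTo c i j) := by
  simp only [Inv, h] at hI
  exact hI

theorem inv_relabel_of_shuffle (hI : Inv vs es c) {k : Fin (n + 1)} (h : c.phase = .shuffle k) :
    Inv vs es { c with phase := .relabel } := by
  simp only [Inv, h] at hI ⊢
  obtain ⟨hout, hspan⟩ := hI
  rw [hout, List.append_nil, edgeGraph_map_eq_comap]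
  exact (SimpleGraph.Iso.comap c.label.symm (edgeGraph c.edges)).isTree_iff.2 hspan.isTree_edgeGraph

theorem edgeGraph_relabel_cons {V : Type*} (e : V × V) (l out : List (V × V))
    (π : Equiv.Perm V) :
    edgeGraph (l.map (Prod.map π π) ++ e.map π π :: out) =
      edgeGraph ((e :: l).map (Prod.map π π) ++ out) := by
  refine edgeGraph_congr fun x => ?_
  simp only [List.mem_append, List.mem_cons, List.map_cons]
  tauto

theorem DetStep.inv (hin : TreeInput vs es) (hs : DetStep c b) (hI : Inv vs es c) :
    Inv vs es b := by
  cases hs with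
  | init_zero h =>
    simp only [Inv, h] at hI
    obtain ⟨hfresh, hV, hE, hedges, hK⟩ := hI
    exact ⟨hfresh, hE, hedges, [], hV, hK⟩
  | init_succ h =>
    simp only [Inv, h] at hI
    exact hI
  | loadVertices_nil h hV =>
    simp only [Inv, h, hV, List.append_nil] at hI ⊢
    obtain ⟨hfresh, hE, hedges, _, rfl, hK⟩ := hI
    exact ⟨hfresh, by rw [hedges, hE]; rfl, hK⟩
  | loadVertices_cons h hV => exact inv_loadVertices_cons hin hI h hV
  | loadEdges_nil h hE => exact inv_choose_of_loadEdges hin hI h hE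
  | loadEdges_cons h hE =>
    simp only [Inv, h, hE, List.reverse_cons, List.append_assoc] at hI ⊢
    exact hI
  | choose_none h h0 =>
    simp only [Inv, h, Growing, treeSet_eq_univ h0] at hI
    obtain ⟨-, -, hout, -, -, hspan⟩ := hI
    exact ⟨hout, hspan⟩
  | erase_self h hp =>
    simp only [Inv, h] at hI
    exact ⟨List.ne_nil_of_mem hI.1, hI.2⟩
  | erase_ne h hp hvu => exact inv_eraseHead hI h hp hvu
  | attach_nil h hp =>
    simp only [Inv, h, hp, headSet] at hI
    exact ⟨hp, hI⟩
  | attach_cons h hp => exact inv_attachHead hI h hp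
  | shuffle_zero h => exact inv_relabel_of_shuffle hI h
  | relabel_nil h hE =>
    simp only [Inv, h, hE, List.map_nil, List.nil_append] at hI
    exact ⟨hE, hI⟩
  | relabel_cons h hE =>
    simp only [Inv, h, hE, ← edgeGraph_relabel_cons] at hI ⊢
    exact hI

theorem inv_step (hin : TreeInput vs es) (c : Config n) (hI : Inv vs es c) :
    ∀ b ∈ (step ⊤ c).support, Inv vs es b := by
  intro b hb
  cases hI.stepCase with
  | det hs =>
    rw [hs.step_eq, PMF.mem_support_pure_iff] at hb
    exact hb ▸ hs.inv hin hI
  | choose h h0 =>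
    rw [step_choose h] at hb
    obtain ⟨i, hi, rfl⟩ := exists_of_mem_support_draw (freeSlots_nonempty h0) hb
    exact inv_startWalk hI h (slot_notMem_treeSet (mem_freeSlots.1 hi))
  | walk h hp =>
    rw [step_walk h hp] at hb
    obtain ⟨u, -, rfl⟩ := exists_of_mem_support_draw (moves_nonempty hin (hI.walk_growing h) hp) hb
    exact inv_moveTo hI h hp u
  | shuffle h =>
    rw [step_shuffle h] at hb
    obtain ⟨j, -, rfl⟩ := exists_of_mem_support_draw Finset.nonempty_Iic hb
    exact inv_shuffleTo hI h _ j
  | done h =>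
    rw [step_done h, PMF.mem_support_pure_iff] at hb
    exact hb ▸ hI

end Preservation

/-! ## The moves of the walker -/

section Moves

variable {V : Type*} [DecidableEq V]

theorem dropWhile_ne_cons_of_ne {a u : V} (l : List V) (h : a ≠ u) :
    (a :: l).dropWhile (· ≠ u) = l.dropWhile (· ≠ u) := by
  simp [h]

theorem dropWhile_ne_cons_self (u : V) (l : List V) : (u :: l).dropWhile (· ≠ u) = u :: l := by
  simp

theorem sum_dropWhile_cons {M : Type*} [AddCommMonoid M] (G : List V → M) {a : V} {l : List V}
    (ha : a ∉ l) :
    ∑ u ∈ (a :: l).toFinset, G ((a :: l).dropWhile (· ≠ u)) =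
      G (a :: l) + ∑ u ∈ l.toFinset, G (l.dropWhile (· ≠ u)) := by
  rw [List.toFinset_cons, Finset.sum_insert (by simpa using ha), dropWhile_ne_cons_self]
  congr 1
  refine Finset.sum_congr rfl fun u hu => ?_
  rw [dropWhile_ne_cons_of_ne]
  rintro rfl
  exact ha (by simpa using hu)

theorem sum_length_dropWhile {M : Type*} [AddCommMonoid M] (g : ℕ → M) {l : List V}
    (hl : l.Nodup) :
    ∑ u ∈ l.toFinset, g (l.dropWhile (· ≠ u)).length = ∑ j ∈ Finset.range l.length, g (j + 1) := by
  induction l with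
  | nil => simp
  | cons a l ih =>
    obtain ⟨ha, hl⟩ := List.nodup_cons.1 hl
    rw [sum_dropWhile_cons (fun l => g l.length) ha, ih hl, List.length_cons, Finset.sum_range_succ,
      add_comm]

/-- The vertices that are neither in the tree nor on the path. -/
def unvisited [Fintype V] (K : Finset V) (path : List V) : Finset V :=
  (K ∪ path.toFinset)ᶜ

theorem mem_unvisited [Fintype V] {K : Finset V} {path : List V} {u : V} :
    u ∈ unvisited K path ↔ u ∉ K ∧ u ∉ path := by
  simp [unvisited]

namespace MarkedPath

variable {K : Finset V} {path rest : List V} {mark : V → Bool} {v : V}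

variable [Fintype V]

theorem card_add_length_add_card (h : MarkedPath K path mark) :
    K.card + path.length + (unvisited K path).card = Fintype.card V := by
  rw [← List.toFinset_card_of_nodup h.nodup, ← Finset.card_union_of_disjoint h.disjoint, unvisited,
    Finset.card_add_card_compl]

theorem cast_card_unvisited (h : MarkedPath K path mark) :
    ((unvisited K path).card : ℝ) = Fintype.card V - K.card - path.length := by
  rw [eq_sub_iff_add_eq, eq_sub_iff_add_eq, ← h.card_add_length_add_card]
  push_cast
  ring

theorem sum_erase_head {M : Type*} [AddCommMonoid M] (h : MarkedPath K (v :: rest) mark)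
    (f : V → M) :
    ∑ u ∈ Finset.univ.erase v, f u =
      ∑ u ∈ K, f u + ∑ u ∈ rest.toFinset, f u + ∑ u ∈ unvisited K (v :: rest), f u := by
  have other_classes : Disjoint (K ∪ rest.toFinset) (unvisited K (v :: rest)) := by
    rw [unvisited, List.toFinset_cons]
    exact disjoint_compl_right.mono_left
      (Finset.union_subset_union_right (Finset.subset_insert _ _))
  rw [← Finset.sum_union h.tail.disjoint, ← Finset.sum_union other_classes]
  refine Finset.sum_congr (Finset.ext fun u => ?_) fun _ _ => rfl
  have hv := h.head_notMem
  have hrest : v ∉ rest := (List.nodup_cons.1 h.nodup).1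
  simp only [Finset.mem_erase, Finset.mem_univ, and_true, Finset.mem_union, List.mem_toFinset,
    mem_unvisited, List.mem_cons, not_or]
  grind

end MarkedPath

variable {n : ℕ} {c : Config n} {u v : Fin n} {rest : List (Fin n)}

theorem moveTo_of_mem_treeSet (hu : u ∈ treeSet c.slot c.free) :
    moveTo c v u = { c with phase := .attach, edges := (v, u) :: c.edges } :=
  if_pos hu

theorem moveTo_of_mem_path (hpath : MarkedPath (treeSet c.slot c.free) (v :: rest) c.mark)
    (hu : u ∈ rest) : moveTo c v u = { c with phase := .erase u } := by
  have hu' : u ∈ v :: rest := List.mem_cons_of_mem _ hu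
  rw [moveTo, if_neg (hpath.notMem u hu'), if_pos ((hpath.mark_iff u).2 hu')]

theorem moveTo_of_mem_unvisited (hpath : MarkedPath (treeSet c.slot c.free) (v :: rest) c.mark)
    (hp : c.path = v :: rest) (hu : u ∈ unvisited (treeSet c.slot c.free) (v :: rest)) :
    moveTo c v u = { c with path := u :: v :: rest, mark := Function.update c.mark u true } := by
  obtain ⟨hK, hrest⟩ := mem_unvisited.1 hu
  rw [moveTo, if_neg hK, if_neg fun h => hrest ((hpath.mark_iff u).1 h), hp]

end Moves

/-! ## The running time -/

section RunningTime

/-- The expected number of walk steps, divided by `n - 1`, until all vertices are in the tree, if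
the tree has `k` vertices and the path has `m + 1`. -/
def walkTime (n k m : ℕ) : ℝ :=
  1 / k + (n - k - 1) / n - k / n * ∑ i ∈ Finset.range m, 1 / ((k : ℝ) + 1 + i)

theorem sum_sum_inv (k : ℕ) (m : ℕ) :
    ∑ j ∈ Finset.range m, ∑ i ∈ Finset.range j, 1 / ((k : ℝ) + 1 + i) =
      (k + m) * ∑ i ∈ Finset.range m, 1 / ((k : ℝ) + 1 + i) - m := by
  induction m with
  | zero => simp
  | succ m ih =>
    rw [Finset.sum_range_succ, ih, Finset.sum_range_succ]
    have : (k : ℝ) + 1 + m ≠ 0 := by positivity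
    push_cast
    field_simp
    ring

theorem walkTime_recurrence {n k m : ℕ} (hn : 0 < n) (hk : 0 < k) :
    k * walkTime n (k + m + 1) 0 + ∑ j ∈ Finset.range m, walkTime n k j +
      ((n : ℝ) - k - (m + 1)) * walkTime n k (m + 1) = (n - 1) * walkTime n k m - 1 := by
  have : (n : ℝ) ≠ 0 := by positivity
  have : (k : ℝ) ≠ 0 := by positivity
  have : (k : ℝ) + m + 1 ≠ 0 := by positivity
  have : (k : ℝ) + 1 + m ≠ 0 := by positivity
  have sum_walkTime : ∑ j ∈ Finset.range m, walkTime n k j = m * (1 / k + (n - k - 1) / n) -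
      k / n * ((k + m) * ∑ i ∈ Finset.range m, 1 / ((k : ℝ) + 1 + i) - m) := by
    simp only [walkTime, Finset.sum_sub_distrib, ← Finset.mul_sum, sum_sum_inv, Finset.sum_const,
      Finset.card_range, nsmul_eq_mul]
  rw [sum_walkTime]
  simp only [walkTime, Finset.sum_range_succ, Finset.range_zero, Finset.sum_empty]
  generalize ∑ i ∈ Finset.range m, 1 / ((k : ℝ) + 1 + i) = s
  push_cast
  field_simp
  ring

theorem walkTime_nonneg {n k m : ℕ} (hk : 0 < k) (h : k + m + 1 ≤ n) : 0 ≤ walkTime n k m := by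
  have hn : (0 : ℝ) < n := by exact_mod_cast (by omega : 0 < n)
  have : (0 : ℝ) < k := by exact_mod_cast hk
  have hkm : (k : ℝ) + m + 1 ≤ n := by exact_mod_cast h
  have sum_le : k * ∑ i ∈ Finset.range m, 1 / ((k : ℝ) + 1 + i) ≤ m := by
    rw [Finset.mul_sum]
    refine (Finset.sum_le_card_nsmul _ _ 1 fun i _ => ?_).trans (by simp)
    rw [mul_one_div, div_le_one (by positivity)]
    linarith [Nat.cast_nonneg (α := ℝ) i]
  calc (0 : ℝ) ≤ 1 / k + ((n - k - 1) - k * ∑ i ∈ Finset.range m, 1 / ((k : ℝ) + 1 + i)) / n :=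
        add_nonneg (by positivity) (div_nonneg (by linarith) hn.le)
    _ = walkTime n k m := by
        rw [walkTime]
        ring

theorem walkTime_self {n : ℕ} (hn : 0 < n) : walkTime n n 0 = 0 := by
  have : (n : ℝ) ≠ 0 := by positivity
  simp only [walkTime, Finset.range_zero, Finset.sum_empty]
  field_simp
  ring

theorem walkTime_zero_nonneg {n k : ℕ} (hk : 0 < k) (h : k ≤ n) : 0 ≤ walkTime n k 0 := by
  rcases h.lt_or_eq with h | rfl
  · exact walkTime_nonneg hk h
  · exact (walkTime_self hk).ge

theorem walkTime_zero_le_two {n k : ℕ} (hk : 0 < k) (h : k ≤ n) : walkTime n k 0 ≤ 2 := by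
  have hk : (1 : ℝ) ≤ k := by exact_mod_cast hk
  have hkn : (k : ℝ) ≤ n := by exact_mod_cast h
  have inv_le : 1 / (k : ℝ) ≤ 1 := (div_le_one (by linarith)).2 hk
  have frac_le : ((n : ℝ) - k - 1) / n ≤ 1 := (div_le_one (by linarith)).2 (by linarith)
  simp only [walkTime, Finset.range_zero, Finset.sum_empty]
  linarith

/-- A bound for the expected number of steps from the choice of a starting vertex, if the tree has
`k` vertices. -/
def choosePotential (n k : ℕ) : ℝ :=
  2 * n + 2 + 2 * (n - 1) * walkTime n k 0 + 2 * (n - k)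

/-- A bound for the expected number of steps from a configuration in the walk, if the tree has `k`
vertices and the path has `m + 1`. -/
def walkPotential (n k m : ℕ) : ℝ :=
  2 * n + 2 * (n - 1) * walkTime n k m + 2 * (n - k) + m + 1

theorem choosePotential_nonneg {n k : ℕ} (hk : 0 < k) (h : k ≤ n) : 0 ≤ choosePotential n k := by
  have hn : (1 : ℝ) ≤ n := by exact_mod_cast hk.trans_le h
  have hkn : (k : ℝ) ≤ n := by exact_mod_cast h
  have := mul_nonneg (sub_nonneg.2 hn) (walkTime_zero_nonneg hk h)
  unfold choosePotential
  linarith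

theorem walkPotential_nonneg {n k m : ℕ} (hk : 0 < k) (h : k + m + 1 ≤ n) :
    0 ≤ walkPotential n k m := by
  have hn : (1 : ℝ) ≤ n := by exact_mod_cast (by omega : 1 ≤ n)
  have hkm : (k : ℝ) + m + 1 ≤ n := by exact_mod_cast h
  have : (0 : ℝ) ≤ m := m.cast_nonneg
  have := mul_nonneg (sub_nonneg.2 hn) (walkTime_nonneg hk h)
  unfold walkPotential
  linarith

theorem choosePotential_self {n : ℕ} (hn : 0 < n) : choosePotential n n = 2 * n + 2 := by
  rw [choosePotential, walkTime_self hn]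
  ring

theorem sum_walkPotential (n k m : ℕ) :
    ∑ j ∈ Finset.range m, (walkPotential n k j + (m + 1) - j) =
      2 * (n - 1) * ∑ j ∈ Finset.range m, walkTime n k j + m * (2 * n + 2 * (n - k) + m + 2) := by
  have summand (j : ℕ) : walkPotential n k j + (m + 1) - j =
      2 * (n - 1) * walkTime n k j + (2 * n + 2 * (n - k) + m + 2) := by
    rw [walkPotential]
    ring
  simp only [summand, Finset.sum_add_distrib, Finset.sum_const, nsmul_eq_mul, Finset.card_range,
    Finset.mul_sum]
  ring

theorem walkPotential_recurrence_le {n k m : ℕ} (hn : 0 < n) (hk : 0 < k) :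
    ((n : ℝ) - 1) + (k * (choosePotential n (k + (m + 1)) + m + 2) +
      ∑ j ∈ Finset.range m, (walkPotential n k j + (m + 1) - j) +
      ((n : ℝ) - k - (m + 1)) * walkPotential n k (m + 1)) ≤ (n - 1) * walkPotential n k m := by
  have hrec := walkTime_recurrence (m := m) hn hk
  have hkm : (0 : ℝ) ≤ k * m := by positivity
  rw [sum_walkPotential]
  simp only [choosePotential, walkPotential]
  push_cast
  rw [← add_assoc k m 1]
  linear_combination 2 * ((n : ℝ) - 1) * hrec + 2 * hkm

end RunningTime

section Potential

variable {n : ℕ} {vs : List (Fin n)} {es : List (Fin n × Fin n)} {c b : Config n}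

/-- A bound for the expected number of steps from a configuration, if the input tree has `k`
vertices. -/
def potential (k : ℕ) (c : Config n) : ℝ :=
  match c.phase with
  | .init j => j + 1 + (c.inV.length + 1) + (c.inE.length + 1) + choosePotential n k
  | .loadVertices => (c.inV.length + 1) + (c.inE.length + 1) + choosePotential n k
  | .loadEdges => (c.inE.length + 1) + choosePotential n k
  | .choose => choosePotential n (treeSet c.slot c.free).card
  | .walk => walkPotential n (treeSet c.slot c.free).card (c.path.length - 1)
  | .erase u => walkPotential n (treeSet c.slot c.free).card
      ((c.path.dropWhile (· ≠ u)).length - 1) + c.path.length -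
      (c.path.dropWhile (· ≠ u)).length + 1
  | .attach => choosePotential n ((treeSet c.slot c.free).card + c.path.length) +
      c.path.length + 1
  | .shuffle i => (i : ℕ) + c.edges.length + 2
  | .relabel => c.edges.length + 1
  | .done => 0

theorem TreeInput.card_pos (hin : TreeInput vs es) : 0 < vs.toFinset.card :=
  hin.spans.nonempty.card_pos

theorem Growing.card_pos (hin : TreeInput vs es) {S : Finset (Fin n)} (hg : Growing vs c S) :
    0 < (treeSet c.slot c.free).card :=
  hin.card_pos.trans_le (Finset.card_le_card hg.2.2.1)

theorem Growing.card_add_length_le {S : Finset (Fin n)} (hg : Growing vs c S) :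
    (treeSet c.slot c.free).card + c.path.length ≤ n := by
  simpa using (hg.markedPath rfl).card_add_length_le

theorem potential_nonneg (hin : TreeInput vs es) (hI : Inv vs es c) :
    0 ≤ potential vs.toFinset.card c := by
  have := choosePotential_nonneg hin.card_pos (card_finset_fin_le vs.toFinset)
  cases h : c.phase with
  | init j => simp only [potential, h]; positivity
  | loadVertices => simp only [potential, h]; positivity
  | loadEdges => simp only [potential, h]; positivity
  | choose =>
    simp only [Inv, h] at hI
    simp only [potential, h]
    exact choosePotential_nonneg (hI.2.card_pos hin) (by have := hI.2.card_add_length_le; omega)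
  | walk =>
    simp only [Inv, h] at hI
    have hlen := hI.2.card_add_length_le
    have hpos := List.length_pos_iff.2 hI.1
    simp only [potential, h]
    exact walkPotential_nonneg (hI.2.card_pos hin) (by omega)
  | erase u =>
    simp only [Inv, h] at hI
    have hlen := hI.2.card_add_length_le
    have hpos := List.length_pos_iff.2 (List.ne_nil_of_mem hI.1)
    have hdrop : (c.path.dropWhile (· ≠ u)).length ≤ c.path.length :=
      (List.dropWhile_sublist _).length_le
    have := walkPotential_nonneg (n := n) (m := (c.path.dropWhile (· ≠ u)).length - 1)
      (hI.2.card_pos hin) (by omega)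
    have : ((c.path.dropWhile (· ≠ u)).length : ℝ) ≤ c.path.length := by exact_mod_cast hdrop
    simp only [potential, h]
    linarith
  | attach =>
    simp only [Inv, h] at hI
    have := choosePotential_nonneg (Nat.add_pos_left (hI.card_pos hin) c.path.length)
      hI.card_add_length_le
    simp only [potential, h]
    positivity
  | shuffle i => simp only [potential, h]; positivity
  | relabel => simp only [potential, h]; positivity
  | done => simp only [potential, h]; exact le_rfl

theorem potential_shuffle_last_le (hin : TreeInput vs es) (hI : Inv vs es c) (h : c.phase = .choose)
    (h0 : (c.free : ℕ) = 0) (k : ℕ) :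
    1 + potential k { c with phase := .shuffle (Fin.last n) } ≤ potential k c := by
  simp only [Inv, h] at hI
  have length_edges : (c.edges.length : ℝ) + 1 = n := by
    exact_mod_cast hI.2.spansTree.length.trans (by simp [treeSet_eq_univ h0])
  simp only [potential, h, treeSet_eq_univ h0, Finset.card_univ, Fintype.card_fin,
    choosePotential_self (hin.card_pos.trans_le (card_finset_fin_le vs.toFinset)), Fin.val_last]
  linarith

theorem potential_attachHead (hI : Inv vs es c) (h : c.phase = .attach) {v : Fin n}
    {rest : List (Fin n)} (hp : c.path = v :: rest) (k : ℕ) :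
    1 + potential k (attachHead c v rest) = potential k c := by
  have hv := ((hI.attach_growing h hp).markedPath hp).head_notMem
  simp only [potential, h, hp, attachHead, addVertex_phase, treeSet_addVertex hv,
    Finset.card_insert_of_notMem hv, List.length_cons]
  rw [add_assoc _ 1, add_comm 1 rest.length]
  push_cast
  ring

theorem DetStep.one_add_potential_le (hin : TreeInput vs es) (hI : Inv vs es c)
    (hs : DetStep c b) :
    1 + potential vs.toFinset.card b ≤ potential vs.toFinset.card c := by
  cases hs with
  | init_zero h | init_succ h =>
    simp only [potential, h]
    push_cast
    linarith
  | loadVertices_nil h hl | loadVertices_cons h hl =>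
    simp only [potential, h, hl, addVertex_phase, addVertex_inE, List.length_cons, List.length_nil]
    push_cast
    linarith
  | loadEdges_nil h hE =>
    simp only [Inv, h] at hI
    simp only [potential, h, hE, hI.2.2, List.length_nil]
    push_cast
    linarith
  | loadEdges_cons h hl | relabel_cons h hl =>
    simp only [potential, h, hl, List.length_cons]
    push_cast
    linarith
  | choose_none h h0 => exact potential_shuffle_last_le hin hI h h0 _
  | erase_self h hp =>
    simp only [potential, h, hp, dropWhile_ne_cons_self]
    linarith
  | erase_ne h hp hvu =>
    simp only [potential, h, hp, dropWhile_ne_cons_of_ne _ hvu, List.length_cons]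
    push_cast
    linarith
  | attach_nil h hp =>
    simp only [potential, h, hp, List.length_nil, Nat.add_zero]
    push_cast
    linarith
  | attach_cons h hp => exact (potential_attachHead hI h hp _).le
  | shuffle_zero h =>
    simp only [potential, h, Fin.val_zero]
    push_cast
    linarith
  | relabel_nil h hE => simp [potential, h, hE]

theorem potential_startWalk (h : c.phase = .choose) (v : Fin n) (k : ℕ) :
    1 + potential k (startWalk c v) = potential k c := by
  simp only [potential, startWalk, h, walkPotential, choosePotential, List.length_singleton]
  push_cast
  ring

theorem potential_shuffleTo {i : Fin n} (h : c.phase = .shuffle i.succ) (j : Fin n) (k : ℕ) :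
    1 + potential k (shuffleTo c i j) = potential k c := by
  simp only [potential, shuffleTo, h, Fin.val_succ, Fin.val_castSucc]
  push_cast
  ring

section Walk

variable {v : Fin n} {rest : List (Fin n)}

theorem sum_potential_moveTo_treeSet (hp : c.path = v :: rest) (k : ℕ) :
    ∑ u ∈ treeSet c.slot c.free, potential k (moveTo c v u) =
      (treeSet c.slot c.free).card *
        (choosePotential n ((treeSet c.slot c.free).card + (rest.length + 1)) +
          rest.length + 2) := by
  rw [← nsmul_eq_mul, ← Finset.sum_const]
  refine Finset.sum_congr rfl fun u hu => ?_
  simp only [moveTo_of_mem_treeSet hu, potential, hp, List.length_cons]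
  push_cast
  ring

theorem sum_potential_moveTo_path
    (hpath : MarkedPath (treeSet c.slot c.free) (v :: rest) c.mark) (hp : c.path = v :: rest)
    (k : ℕ) :
    ∑ u ∈ rest.toFinset, potential k (moveTo c v u) = ∑ j ∈ Finset.range rest.length,
      (walkPotential n (treeSet c.slot c.free).card j + (rest.length + 1) - j) := by
  set g : ℕ → ℝ := fun d =>
    walkPotential n (treeSet c.slot c.free).card (d - 1) + (rest.length + 1) - d + 1
  calc ∑ u ∈ rest.toFinset, potential k (moveTo c v u)
      = ∑ u ∈ rest.toFinset, g (rest.dropWhile (· ≠ u)).length := by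
        refine Finset.sum_congr rfl fun u hu => ?_
        rw [List.mem_toFinset] at hu
        simp only [moveTo_of_mem_path hpath hu, potential, hp,
          dropWhile_ne_cons_of_ne rest (hpath.ne_head hu), List.length_cons, g]
        push_cast
        rfl
    _ = ∑ j ∈ Finset.range rest.length, g (j + 1) :=
        sum_length_dropWhile g (List.nodup_cons.1 hpath.nodup).2
    _ = _ := by
        refine Finset.sum_congr rfl fun j _ => ?_
        simp only [g, Nat.add_sub_cancel]
        push_cast
        ring

theorem sum_potential_moveTo_unvisited (h : c.phase = .walk)
    (hpath : MarkedPath (treeSet c.slot c.free) (v :: rest) c.mark) (hp : c.path = v :: rest)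
    (k : ℕ) :
    ∑ u ∈ unvisited (treeSet c.slot c.free) (v :: rest), potential k (moveTo c v u) =
      ((n : ℝ) - (treeSet c.slot c.free).card - (rest.length + 1)) *
        walkPotential n (treeSet c.slot c.free).card (rest.length + 1) := by
  have card_unvisited := hpath.cast_card_unvisited
  rw [Fintype.card_fin, List.length_cons, Nat.cast_succ] at card_unvisited
  rw [← card_unvisited, ← nsmul_eq_mul, ← Finset.sum_const]
  refine Finset.sum_congr rfl fun u hu => ?_
  simp only [moveTo_of_mem_unvisited hpath hp hu, potential, h, List.length_cons,
    Nat.add_sub_cancel]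

theorem card_moves (v : Fin n) : ((Finset.univ.erase v).card : ℝ) = (n : ℝ) - 1 := by
  rw [Finset.cast_card_erase_of_mem (Finset.mem_univ v), Finset.card_univ, Fintype.card_fin]

theorem card_moves_add_sum_potential_le (hin : TreeInput vs es) (hI : Inv vs es c)
    (h : c.phase = .walk) (hp : c.path = v :: rest) (k : ℕ) :
    (Finset.univ.erase v).card + ∑ u ∈ Finset.univ.erase v, potential k (moveTo c v u) ≤
      (Finset.univ.erase v).card * potential k c := by
  have hg := hI.walk_growing h
  have hpath := hg.markedPath hp
  have potential_eq : potential k c = walkPotential n (treeSet c.slot c.free).card rest.length := by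
    simp [potential, h, hp]
  rw [hpath.sum_erase_head, sum_potential_moveTo_treeSet hp, sum_potential_moveTo_path hpath hp,
    sum_potential_moveTo_unvisited h hpath hp, card_moves, potential_eq]
  exact walkPotential_recurrence_le v.pos (hg.card_pos hin)

end Walk

theorem one_add_ofReal_le {x y : ℝ} (hx : 0 ≤ x) (hxy : 1 + x ≤ y) :
    1 + ENNReal.ofReal x ≤ ENNReal.ofReal y := by
  rw [← ENNReal.ofReal_one, ← ENNReal.ofReal_add zero_le_one hx]
  exact ENNReal.ofReal_le_ofReal hxy

theorem one_add_expect_draw_ofReal_le {α : Type} {s : Finset α} (hs : s.Nonempty)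
    {f : α → Config n} {h : Config n → ℝ} (h0 : ∀ a ∈ s, 0 ≤ h (f a)) {x : ℝ}
    (hx : s.card + ∑ a ∈ s, h (f a) ≤ s.card * x) :
    1 + expect (draw s f c) (fun c => ENNReal.ofReal (h c)) ≤ ENNReal.ofReal x := by
  have card_pos : (0 : ℝ) < s.card := by exact_mod_cast hs.card_pos
  rw [expect_draw_ofReal hs h0]
  refine one_add_ofReal_le (div_nonneg (Finset.sum_nonneg h0) card_pos.le) ?_
  rw [← le_sub_iff_add_le', div_le_iff₀ card_pos]
  linarith

theorem one_add_expect_draw_ofReal_le_of_forall {α : Type} {s : Finset α} (hs : s.Nonempty)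
    {f : α → Config n} {h : Config n → ℝ} (h0 : ∀ a ∈ s, 0 ≤ h (f a)) {x : ℝ}
    (hx : ∀ a, 1 + h (f a) = x) :
    1 + expect (draw s f c) (fun c => ENNReal.ofReal (h c)) ≤ ENNReal.ofReal x := by
  refine one_add_expect_draw_ofReal_le hs h0 (le_of_eq ?_)
  rw [Finset.card_eq_sum_ones, Nat.cast_sum, ← Finset.sum_add_distrib, Finset.sum_mul]
  exact Finset.sum_congr rfl fun a _ => by rw [Nat.cast_one, one_mul, hx]

theorem indicator_add_expect_potential_le (hin : TreeInput vs es) (hI : Inv vs es c) :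
    ({c | c.phase ≠ .done} : Set (Config n)).indicator 1 c +
      expect (step ⊤ c) (fun c => ENNReal.ofReal (potential vs.toFinset.card c)) ≤
      ENNReal.ofReal (potential vs.toFinset.card c) := by
  have indicator_le : ({c | c.phase ≠ .done} : Set (Config n)).indicator 1 c ≤ (1 : ℝ≥0∞) :=
    Set.indicator_le_self' (by simp) c
  have nonneg {b : Config n} (hb : Inv vs es b) := potential_nonneg hin hb
  cases hI.stepCase with
  | det hs =>
    refine (add_le_add_left indicator_le _).trans ?_
    rw [hs.step_eq, expect_pure]
    exact one_add_ofReal_le (nonneg (hs.inv hin hI)) (hs.one_add_potential_le hin hI)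
  | choose h h0 =>
    refine (add_le_add_left indicator_le _).trans ?_
    rw [step_choose h]
    exact one_add_expect_draw_ofReal_le_of_forall (freeSlots_nonempty h0)
      (fun i hi => nonneg (inv_startWalk hI h (slot_notMem_treeSet (mem_freeSlots.1 hi))))
      fun i => potential_startWalk h (c.slot i) _
  | walk h hp =>
    refine (add_le_add_left indicator_le _).trans ?_
    rw [step_walk h hp]
    exact one_add_expect_draw_ofReal_le (moves_nonempty hin (hI.walk_growing h) hp)
      (fun u _ => nonneg (inv_moveTo hI h hp u)) (card_moves_add_sum_potential_le hin hI h hp _)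
  | shuffle h =>
    refine (add_le_add_left indicator_le _).trans ?_
    rw [step_shuffle h]
    exact one_add_expect_draw_ofReal_le_of_forall Finset.nonempty_Iic
      (fun j _ => nonneg (inv_shuffleTo hI h _ j)) fun j => potential_shuffleTo h j _
  | done h =>
    rw [step_done h, expect_pure, Set.indicator_of_notMem (not_not.2 h), zero_add]

theorem potential_start_le (hin : TreeInput vs es) :
    potential vs.toFinset.card (start vs es) ≤ 15 * n := by
  have card_pos : (1 : ℝ) ≤ vs.toFinset.card := by exact_mod_cast hin.card_pos
  have card_le : (vs.toFinset.card : ℝ) ≤ n := by exact_mod_cast card_finset_fin_le vs.toFinset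
  have length_vs : (vs.length : ℝ) = vs.toFinset.card := by
    rw [List.toFinset_card_of_nodup hin.nodup]
  have length_es : (es.length : ℝ) + 1 = vs.toFinset.card := by exact_mod_cast hin.spans.length
  have := mul_le_mul_of_nonneg_left
    (walkTime_zero_le_two hin.card_pos (card_finset_fin_le vs.toFinset))
    (by linarith : (0 : ℝ) ≤ (n : ℝ) - 1)
  simp only [potential, start, choosePotential]
  linarith

theorem expectedTime_le (hin : TreeInput vs es) : expectedTime vs es ≤ 15 * n := by
  simp only [expectedTime, law_eq_chain, toOuterMeasure_eq_expect]
  calc _ ≤ ENNReal.ofReal (potential vs.toFinset.card (start vs es)) :=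
        tsum_expect_chain_le_of_potential inv_start (inv_step hin) fun c hI =>
          indicator_add_expect_potential_le hin hI
    _ ≤ ENNReal.ofReal (15 * n) := ENNReal.ofReal_le_ofReal (potential_start_le hin)
    _ = 15 * n := by
        rw [ENNReal.ofReal_mul (by norm_num), ENNReal.ofReal_natCast, ENNReal.ofReal_ofNat]

end Potential

/-! ## The probability that the grown tree is a given tree -/

section Weights

/-- The probability that Wilson's algorithm on `n` vertices completes a tree with `k` vertices to a
given spanning tree that contains it. -/
def completionWeight (n k : ℕ) : ℝ := (n : ℝ) ^ (k + 1) / ((n : ℝ) ^ n * k)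

theorem completionWeight_nonneg (n k : ℕ) : 0 ≤ completionWeight n k := by
  unfold completionWeight
  positivity

theorem completionWeight_succ {n k : ℕ} (hn : 0 < n) (hk : 0 < k) :
    completionWeight n (k + 1) * (k + 1) = completionWeight n k * (n * k) := by
  have : (n : ℝ) ≠ 0 := by positivity
  have : (k : ℝ) ≠ 0 := by positivity
  have : (k : ℝ) + 1 ≠ 0 := by positivity
  unfold completionWeight
  push_cast
  field_simp
  ring

theorem completionWeight_self {n : ℕ} (hn : 0 < n) : completionWeight n n = 1 := by
  have : (n : ℝ) ≠ 0 := by positivity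
  unfold completionWeight
  field_simp
  ring

theorem completionWeight_le_one {n k : ℕ} (hk : 0 < k) (h : k ≤ n) : completionWeight n k ≤ 1 := by
  rcases h.lt_or_eq with h | rfl
  · have one_le_n : (1 : ℝ) ≤ n := by exact_mod_cast (by omega : 1 ≤ n)
    have one_le_k : (1 : ℝ) ≤ k := by exact_mod_cast hk
    unfold completionWeight
    rw [div_le_one (by positivity)]
    calc (n : ℝ) ^ (k + 1) ≤ (n : ℝ) ^ n := pow_le_pow_right₀ one_le_n h
      _ ≤ (n : ℝ) ^ n * k := le_mul_of_one_le_right (by positivity) one_le_k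
  · exact (completionWeight_self hk).le

variable {V : Type*} {p : V → V}

/-- The path, whose head is the position of the walker, follows the parent map `p`. -/
def Follows (p : V → V) : List V → Prop := List.IsChain fun a b => p b = a

theorem follows_nil : Follows p [] := List.isChain_nil

theorem follows_singleton (v : V) : Follows p [v] := List.isChain_singleton v

theorem follows_cons_cons {u v : V} {l : List V} :
    Follows p (u :: v :: l) ↔ p v = u ∧ Follows p (v :: l) := List.isChain_cons_cons

theorem rank_le_of_follows {r : V} {d : V → ℕ} (hd : ∀ v, v ≠ r → d (p v) < d v) {v : V}
    {l : List V} (hf : Follows p (v :: l)) (hr : r ∉ v :: l) : ∀ x ∈ v :: l, d v ≤ d x := by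
  induction l generalizing v with
  | nil => simp
  | cons w l ih =>
    obtain ⟨hw, hf⟩ := follows_cons_cons.1 hf
    have hr' : r ∉ w :: l := fun h => hr (List.mem_cons_of_mem _ h)
    have hvw : d v < d w := hw ▸ hd w fun h => hr' (h ▸ List.mem_cons_self)
    exact List.forall_mem_cons.2 ⟨le_rfl, fun x hx => hvw.le.trans (ih hf hr' x hx)⟩

theorem ParentMap.notMem_of_follows {T : SimpleGraph V} {r : V} (hp : ParentMap T r p) {v : V}
    {l : List V} (hf : Follows p (v :: l)) (hr : r ∉ v :: l) : p v ∉ v :: l := by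
  obtain ⟨d, hd⟩ := hp.rank
  intro h
  exact (hd v fun hvr => hr (hvr ▸ List.mem_cons_self)).not_ge (rank_le_of_follows hd hf hr _ h)

variable {n k : ℕ} {l : List V}

open Classical in
/-- The part of `pathWeight n p k (u :: l)` that comes from the event that the walk returns to `l`,
so that `u` is erased. It does not depend on `u`. -/
def detourWeight (n : ℕ) (p : V → V) (k : ℕ) : List V → ℝ
  | [] => 0
  | v :: l => detourWeight n p k l +
      if Follows p (v :: l) then completionWeight n (k + l.length) / (k + l.length + 1) else 0

open Classical in
/-- The probability that Wilson's algorithm on `n` vertices completes a tree with `k` vertices to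
the tree with parent map `p`, if the current loop-erased walk is `l`. -/
def pathWeight (n : ℕ) (p : V → V) (k : ℕ) : List V → ℝ
  | [] => 0
  | v :: l => detourWeight n p k l +
      if Follows p (v :: l) then completionWeight n (k + l.length) else 0

theorem detourWeight_nonneg (l : List V) : 0 ≤ detourWeight n p k l := by
  induction l with
  | nil => exact le_rfl
  | cons v l ih =>
    have := completionWeight_nonneg n (k + l.length)
    rw [detourWeight]
    split_ifs <;> positivity

theorem pathWeight_nonneg (l : List V) : 0 ≤ pathWeight n p k l := by
  cases l with
  | nil => exact le_rfl
  | cons v l =>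
    have := completionWeight_nonneg n (k + l.length)
    have := detourWeight_nonneg (n := n) (p := p) (k := k) l
    rw [pathWeight]
    split_ifs <;> positivity

theorem detourWeight_le (hk : 0 < k) (h : k + l.length ≤ n) : detourWeight n p k l ≤ l.length := by
  induction l with
  | nil => simp [detourWeight]
  | cons v l ih =>
    rw [List.length_cons] at h
    have weight_le : completionWeight n (k + l.length) / (k + l.length + 1) ≤ 1 := by
      refine div_le_one_of_le₀ ?_ (by positivity)
      refine (completionWeight_le_one (by omega) (by omega)).trans ?_
      exact le_add_of_nonneg_left (by positivity)
    rw [detourWeight, List.length_cons, Nat.cast_succ]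
    split_ifs <;> linarith [ih (by omega)]

theorem pathWeight_le (hk : 0 < k) (h : k + l.length ≤ n) : pathWeight n p k l ≤ l.length := by
  cases l with
  | nil => simp [pathWeight]
  | cons v l =>
    rw [List.length_cons] at h
    have := completionWeight_le_one (n := n) (k := k + l.length) (by omega) (by omega)
    have := detourWeight_le (n := n) (p := p) hk (l := l) (by omega)
    rw [pathWeight, List.length_cons, Nat.cast_succ]
    split_ifs <;> linarith

theorem sum_pathWeight_dropWhile [DecidableEq V] (hk : 0 < k) (hl : l.Nodup) :
    ∑ u ∈ l.toFinset, pathWeight n p k (l.dropWhile (· ≠ u)) =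
      (k + l.length) * detourWeight n p k l := by
  induction l with
  | nil => simp [detourWeight]
  | cons v l ih =>
    obtain ⟨hv, hl⟩ := List.nodup_cons.1 hl
    have : (k : ℝ) + l.length + 1 ≠ 0 := by positivity
    rw [sum_dropWhile_cons _ hv, ih hl, pathWeight, detourWeight, List.length_cons, Nat.cast_succ]
    split_ifs
    · field_simp
      ring
    · ring

open Classical in
theorem pathWeight_recurrence (hn : 0 < n) (hk : 0 < k) (v : V) (l : List V) :
    (k + l.length) * detourWeight n p k l +
      ((n : ℝ) - k - (l.length + 1)) * detourWeight n p k (v :: l) +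
      (if Follows p (v :: l) then completionWeight n (k + l.length + 1) else 0) =
      ((n : ℝ) - 1) * pathWeight n p k (v :: l) := by
  have weight_succ := completionWeight_succ (n := n) (k := k + l.length) hn (by omega)
  push_cast at weight_succ
  have : (k : ℝ) + l.length + 1 ≠ 0 := by positivity
  rw [pathWeight, detourWeight]
  split_ifs
  · rw [eq_div_of_mul_eq this weight_succ]
    field_simp
    ring
  · ring

end Weights

section TreeValue

variable {n : ℕ} {vs : List (Fin n)} {es : List (Fin n × Fin n)} {c b : Config n}
  {T : SimpleGraph (Fin n)} {r : Fin n} {p : Fin n → Fin n}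

open Classical in
/-- The probability that the tree grown from `vs` and `es` will be `T`, with parent map `p`, given
the current memory. -/
def treeValue (vs : List (Fin n)) (es : List (Fin n × Fin n)) (T : SimpleGraph (Fin n))
    (p : Fin n → Fin n) (c : Config n) : ℝ :=
  match c.phase with
  | .choose => if ∀ e ∈ c.edges, T.Adj e.1 e.2 then
      completionWeight n (treeSet c.slot c.free).card else 0
  | .walk => if ∀ e ∈ c.edges, T.Adj e.1 e.2 then
      pathWeight n p (treeSet c.slot c.free).card c.path else 0
  | .erase u => if ∀ e ∈ c.edges, T.Adj e.1 e.2 then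
      pathWeight n p (treeSet c.slot c.free).card (c.path.dropWhile (· ≠ u)) else 0
  | .attach => if (∀ e ∈ c.edges, T.Adj e.1 e.2) ∧ Follows p c.path then
      completionWeight n ((treeSet c.slot c.free).card + c.path.length) else 0
  | _ => if ∀ e ∈ es, T.Adj e.1 e.2 then completionWeight n vs.toFinset.card else 0

theorem treeValue_nonneg : 0 ≤ treeValue vs es T p c := by
  have hw := completionWeight_nonneg n
  unfold treeValue
  split <;> split_ifs <;> first | exact hw _ | exact pathWeight_nonneg _ | exact le_rfl

theorem treeValue_le (hin : TreeInput vs es) (hI : Inv vs es c) : treeValue vs es T p c ≤ n := by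
  classical
  have one_le : (1 : ℝ) ≤ n := by
    exact_mod_cast hin.card_pos.trans_le (card_finset_fin_le vs.toFinset)
  have ite_le {P : Prop} [Decidable P] {x : ℝ} (hx : x ≤ n) : (if P then x else 0) ≤ (n : ℝ) := by
    split_ifs <;> linarith
  have input_le : completionWeight n vs.toFinset.card ≤ n :=
    (completionWeight_le_one hin.card_pos (card_finset_fin_le _)).trans one_le
  unfold treeValue
  split <;> refine ite_le ?_
  case h_1 h =>
    simp only [Inv, h] at hI
    exact (completionWeight_le_one (hI.2.card_pos hin) (card_finset_fin_le _)).trans one_le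
  case h_2 h =>
    simp only [Inv, h] at hI
    have length_le := hI.2.card_add_length_le
    exact (pathWeight_le (hI.2.card_pos hin) length_le).trans (by exact_mod_cast (by omega))
  case h_3 u h =>
    simp only [Inv, h] at hI
    have length_le := hI.2.card_add_length_le
    have drop_le : (c.path.dropWhile (· ≠ u)).length ≤ c.path.length :=
      (List.dropWhile_sublist _).length_le
    exact (pathWeight_le (hI.2.card_pos hin) (by omega)).trans (Nat.cast_le.2 (by omega))
  case h_4 h =>
    simp only [Inv, h] at hI
    exact (completionWeight_le_one (Nat.add_pos_left (hI.card_pos hin) _)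
      hI.card_add_length_le).trans one_le
  case h_5 => exact input_le

theorem treeValue_startWalk (h : c.phase = .choose) (v : Fin n) :
    treeValue vs es T p (startWalk c v) = treeValue vs es T p c := by
  classical
  simp [treeValue, startWalk, h, pathWeight, detourWeight, follows_singleton]

section Walk

variable {v : Fin n} {rest : List (Fin n)}

theorem treeValue_moveTo_eq_zero (h : c.phase = .walk) (hE : ¬∀ e ∈ c.edges, T.Adj e.1 e.2)
    (u : Fin n) : treeValue vs es T p (moveTo c v u) = 0 := by
  unfold moveTo
  split_ifs <;> simp only [treeValue, h, List.forall_mem_cons, hE, and_false, false_and,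
    if_false]

open Classical in
theorem sum_treeValue_moveTo_treeSet (hE : ∀ e ∈ c.edges, T.Adj e.1 e.2)
    (hspan : SpansTree c.edges (treeSet c.slot c.free)) (hT : ParentMap T r p)
    (hr : r ∈ treeSet c.slot c.free) (hv : v ∉ treeSet c.slot c.free) (hp : c.path = v :: rest) :
    ∑ u ∈ treeSet c.slot c.free, treeValue vs es T p (moveTo c v u) =
      if p v ∈ treeSet c.slot c.free then
        if Follows p (v :: rest) then
          completionWeight n ((treeSet c.slot c.free).card + rest.length + 1) else 0
      else 0 := by
  rw [← Finset.sum_ite_eq (treeSet c.slot c.free) (p v) fun _ => _]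
  refine Finset.sum_congr rfl fun u hu => ?_
  rw [moveTo_of_mem_treeSet hu, ← ite_and]
  simp only [treeValue, hp, List.forall_mem_cons, hspan.adj_iff_parent_eq hT hE hr hu hv,
    List.length_cons, ← add_assoc, and_iff_left hE]

theorem sum_treeValue_moveTo_path (hE : ∀ e ∈ c.edges, T.Adj e.1 e.2)
    (hpath : MarkedPath (treeSet c.slot c.free) (v :: rest) c.mark) (hp : c.path = v :: rest)
    (hk : 0 < (treeSet c.slot c.free).card) :
    ∑ u ∈ rest.toFinset, treeValue vs es T p (moveTo c v u) =
      ((treeSet c.slot c.free).card + rest.length) *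
        detourWeight n p (treeSet c.slot c.free).card rest := by
  classical
  rw [← sum_pathWeight_dropWhile hk (List.nodup_cons.1 hpath.nodup).2]
  refine Finset.sum_congr rfl fun u hu => ?_
  rw [List.mem_toFinset] at hu
  simp only [moveTo_of_mem_path hpath hu, treeValue, hp,
    dropWhile_ne_cons_of_ne rest (hpath.ne_head hu)]
  exact if_pos hE

open Classical in
theorem sum_treeValue_moveTo_unvisited (h : c.phase = .walk) (hE : ∀ e ∈ c.edges, T.Adj e.1 e.2)
    (hpath : MarkedPath (treeSet c.slot c.free) (v :: rest) c.mark) (hp : c.path = v :: rest) :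
    ∑ u ∈ unvisited (treeSet c.slot c.free) (v :: rest), treeValue vs es T p (moveTo c v u) =
      ((n : ℝ) - (treeSet c.slot c.free).card - (rest.length + 1)) *
        detourWeight n p (treeSet c.slot c.free).card (v :: rest) +
      if p v ∈ unvisited (treeSet c.slot c.free) (v :: rest) then
        if Follows p (v :: rest) then
          completionWeight n ((treeSet c.slot c.free).card + rest.length + 1) else 0
      else 0 := by
  have card_unvisited := hpath.cast_card_unvisited
  rw [Fintype.card_fin, List.length_cons, Nat.cast_succ] at card_unvisited
  rw [← card_unvisited, ← nsmul_eq_mul, ← Finset.sum_const,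
    ← Finset.sum_ite_eq (unvisited _ _) (p v) fun _ => _, ← Finset.sum_add_distrib]
  refine Finset.sum_congr rfl fun u hu => ?_
  rw [moveTo_of_mem_unvisited hpath hp hu, ← ite_and]
  simp only [treeValue, h, pathWeight, follows_cons_cons, List.length_cons, ← add_assoc, if_pos hE]

theorem sum_treeValue_moveTo (hin : TreeInput vs es) (hI : Inv vs es c) (hr : r ∈ vs.toFinset)
    (hT : ParentMap T r p) (h : c.phase = .walk) (hp : c.path = v :: rest) :
    ∑ u ∈ Finset.univ.erase v, treeValue vs es T p (moveTo c v u) =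
      ((n : ℝ) - 1) * treeValue vs es T p c := by
  by_cases hE : ∀ e ∈ c.edges, T.Adj e.1 e.2
  swap
  · simp only [treeValue_moveTo_eq_zero h hE, Finset.sum_const_zero]
    simp only [treeValue, h, if_neg hE, mul_zero]
  have hg := hI.walk_growing h
  have hpath := hg.markedPath hp
  have hk := hg.card_pos hin
  have root_mem : r ∈ treeSet c.slot c.free := hg.2.2.1 hr
  have parent_cases (hf : Follows p (v :: rest)) :
      p v ∈ unvisited (treeSet c.slot c.free) (v :: rest) ↔ p v ∉ treeSet c.slot c.free := by
    have := hT.notMem_of_follows hf fun h => hpath.notMem r h root_mem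
    simp only [mem_unvisited, this, not_false_iff, and_true]
  rw [hpath.sum_erase_head, sum_treeValue_moveTo_path hE hpath hp hk,
    sum_treeValue_moveTo_treeSet hE hg.spansTree hT root_mem hpath.head_notMem hp,
    sum_treeValue_moveTo_unvisited h hE hpath hp]
  simp only [treeValue, h, hp]
  rw [if_pos hE, ← pathWeight_recurrence v.pos hk]
  by_cases hf : Follows p (v :: rest)
  · simp only [parent_cases hf, if_pos hf, ite_not]
    split_ifs <;> ring
  · simp only [if_neg hf, ite_self]
    ring

end Walk

theorem treeValue_attachHead (hI : Inv vs es c) (hr : r ∈ vs.toFinset) (hT : ParentMap T r p)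
    (h : c.phase = .attach) {v : Fin n} {rest : List (Fin n)} (hp : c.path = v :: rest) :
    treeValue vs es T p (attachHead c v rest) = treeValue vs es T p c := by
  classical
  have hg := hI.attach_growing h hp
  have hpath := hg.markedPath hp
  have hv := hpath.head_notMem
  have root_mem : r ∈ insert v (treeSet c.slot c.free) := Finset.mem_insert_of_mem (hg.2.2.1 hr)
  have good_iff : ((∀ e ∈ (rest.head?.map fun w => (w, v)).toList ++ c.edges, T.Adj e.1 e.2) ∧
      Follows p rest) ↔ (∀ e ∈ c.edges, T.Adj e.1 e.2) ∧ Follows p (v :: rest) := by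
    cases rest with
    | nil => simp [follows_nil, follows_singleton]
    | cons w rest =>
      have hw : w ∉ insert v (treeSet c.slot c.free) :=
        hpath.tail_insert.notMem w List.mem_cons_self
      simp only [List.head?_cons, Option.map_some, Option.toList_some, List.singleton_append,
        List.forall_mem_cons, follows_cons_cons]
      rw [and_comm (a := T.Adj w v), and_assoc]
      refine and_congr_right fun hE => and_congr_left fun _ => ?_
      exact hg.spansTree.adj_iff_parent_eq hT hE root_mem (Finset.mem_insert_self _ _) hw
  have card_eq : (treeSet c.slot c.free).card + 1 + rest.length =
      (treeSet c.slot c.free).card + (rest.length + 1) := by omega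
  simp only [treeValue, attachHead, addVertex_phase, h, hp, treeSet_addVertex hv,
    Finset.card_insert_of_notMem hv, List.length_cons, good_iff, card_eq]

/-- The phases before the shuffle. -/
def IsGrowthPhase : Phase n → Prop
  | .shuffle _ | .relabel | .done => False
  | _ => True

theorem DetStep.treeValue_eq (hI : Inv vs es c) (hr : r ∈ vs.toFinset) (hT : ParentMap T r p)
    (hs : DetStep c b) (hb : IsGrowthPhase b.phase) :
    treeValue vs es T p b = treeValue vs es T p c := by
  classical
  cases hs with
  | init_zero h | init_succ h | loadVertices_nil h | loadVertices_cons h | loadEdges_cons h =>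
    simp only [treeValue, addVertex_phase, h]
  | loadEdges_nil h hE =>
    simp only [Inv, h, hE, List.append_nil] at hI
    simp only [treeValue, h, hI.2.2, ← hI.2.1, List.mem_reverse]
  | erase_self h hp => simp only [treeValue, h, hp, dropWhile_ne_cons_self]
  | erase_ne h hp hvu => simp only [treeValue, h, hp, dropWhile_ne_cons_of_ne _ hvu]
  | attach_nil h hp =>
    simp only [treeValue, h, hp, follows_nil, and_true, List.length_nil, Nat.add_zero]
  | attach_cons h hp => exact treeValue_attachHead hI hr hT h hp
  | choose_none | shuffle_zero | relabel_nil => exact hb.elim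
  | relabel_cons h => exact (h ▸ hb : IsGrowthPhase .relabel).elim

end TreeValue

/-! ## The probability of an output -/

section Fixing

open Equiv

variable {n : ℕ}

/-- The permutations that move only the first `i` labels: the possible outcomes of the rest of the
shuffle when `i` cells remain to be treated. -/
def fixing (n i : ℕ) : Finset (Perm (Fin n)) :=
  Finset.univ.filter fun π => ∀ x : Fin n, i ≤ x → π x = x

theorem mem_fixing {i : ℕ} {π : Perm (Fin n)} : π ∈ fixing n i ↔ ∀ x : Fin n, i ≤ x → π x = x := by
  simp [fixing]

theorem fixing_self : fixing n n = Finset.univ :=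
  Finset.filter_true_of_mem fun _ _ x hx => absurd x.isLt hx.not_gt

theorem fixing_zero : fixing n 0 = {1} := by
  ext π
  simp [mem_fixing, Equiv.ext_iff]

theorem apply_le_of_mem_fixing_succ {i : Fin n} {π : Perm (Fin n)} (hπ : π ∈ fixing n (i + 1)) :
    π i ≤ i := by
  by_contra! h
  exact h.ne' (π.injective (mem_fixing.1 hπ _ h))

theorem swap_mul_mem_fixing_iff {i j : Fin n} (hj : j ≤ i) (π : Perm (Fin n)) :
    swap i j * π ∈ fixing n i ↔ π ∈ fixing n (i + 1) ∧ π i = j := by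
  have apply_iff (x : Fin n) : (swap i j * π) x = x ↔ π x = swap i j x := by
    rw [Perm.mul_apply, swap_apply_eq_iff]
  have swap_eq {x : Fin n} (hx : i < x) : swap i j x = x :=
    swap_apply_of_ne_of_ne hx.ne' (hj.trans_lt hx).ne'
  simp only [mem_fixing, apply_iff, Fin.val_fin_le, Nat.succ_le_iff, Fin.val_fin_lt]
  constructor
  · exact fun h => ⟨fun x hx => (h x hx.le).trans (swap_eq hx), by simpa using h i le_rfl⟩
  · rintro ⟨h, hi⟩ x hx
    rcases hx.lt_or_eq with hx | rfl
    · rw [h x hx, swap_eq hx]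
    · rw [hi, swap_apply_left]

theorem sum_fixing_succ (i : Fin n) (F : Perm (Fin n) → ℝ) :
    ∑ π ∈ fixing n (i + 1), F π = ∑ j ∈ Finset.Iic i, ∑ π ∈ fixing n i, F (swap i j * π) := by
  rw [← Finset.sum_fiberwise_of_maps_to fun π hπ =>
    Finset.mem_Iic.2 (apply_le_of_mem_fixing_succ hπ)]
  refine Finset.sum_congr rfl fun j hj => ?_
  refine Finset.sum_equiv (Equiv.mulLeft (swap i j)) (fun π => ?_) fun π _ => ?_
  · rw [Finset.mem_filter, coe_mulLeft, swap_mul_mem_fixing_iff (Finset.mem_Iic.1 hj)]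
  · rw [coe_mulLeft, swap_mul_self_mul]

end Fixing

section Relabelling

variable {V : Type*} {T : SimpleGraph V}

theorem isTree_comap (hT : T.IsTree) (π : Equiv.Perm V) : (T.comap π).IsTree :=
  (SimpleGraph.Iso.comap π T).isTree_iff.2 hT

theorem edgeGraph_map_eq_iff (π : Equiv.Perm V) (E : List (V × V)) :
    edgeGraph (E.map (Prod.map π π)) = T ↔ edgeGraph E = T.comap π := by
  rw [edgeGraph_map_eq_comap]
  constructor
  · rintro rfl
    ext a b
    simp
  · intro h
    ext a b
    simp [h]

end Relabelling

section Output

variable {n : ℕ} {vs : List (Fin n)} {es : List (Fin n × Fin n)} {c b : Config n}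
  {T : SimpleGraph (Fin n)} {r : Fin n} {p : Equiv.Perm (Fin n) → Fin n → Fin n}

/-- The probability of the output `T` while the tree is still growing; `p π` is a parent map of
`T.comap π`, the tree that has to be grown if the shuffle produces the permutation `π`. -/
def growingValue (vs : List (Fin n)) (es : List (Fin n × Fin n)) (T : SimpleGraph (Fin n))
    (p : Equiv.Perm (Fin n) → Fin n → Fin n) (c : Config n) : ℝ :=
  (∑ π : Equiv.Perm (Fin n), treeValue vs es (T.comap π) (p π) c) / n.factorial

open Classical in
/-- The probability of the output `T`, given the current memory. -/
def outputValue (vs : List (Fin n)) (es : List (Fin n × Fin n)) (T : SimpleGraph (Fin n))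
    (p : Equiv.Perm (Fin n) → Fin n → Fin n) (c : Config n) : ℝ :=
  match c.phase with
  | .shuffle i => (∑ π ∈ fixing n i,
      if edgeGraph (c.edges.map (Prod.map (c.label * π) (c.label * π))) = T then 1 else 0) /
        (i : ℕ).factorial
  | .relabel => if edgeGraph (c.edges.map (Prod.map c.label c.label) ++ c.out) = T then 1 else 0
  | .done => if edgeGraph c.out = T then 1 else 0
  | _ => growingValue vs es T p c

theorem outputValue_of_isGrowthPhase (h : IsGrowthPhase c.phase) :
    outputValue vs es T p c = growingValue vs es T p c := by
  unfold outputValue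
  split <;> simp_all [IsGrowthPhase]

theorem growingValue_nonneg : 0 ≤ growingValue vs es T p c :=
  div_nonneg (Finset.sum_nonneg fun _ _ => treeValue_nonneg) (by positivity)

theorem growingValue_le (hin : TreeInput vs es) (hI : Inv vs es c) :
    growingValue vs es T p c ≤ n := by
  rw [growingValue, div_le_iff₀ (by positivity)]
  calc _ ≤ ∑ _π : Equiv.Perm (Fin n), (n : ℝ) := Finset.sum_le_sum fun π _ => treeValue_le hin hI
    _ = n * n.factorial := by
      rw [Finset.sum_const, Finset.card_univ, Fintype.card_perm, Fintype.card_fin, nsmul_eq_mul,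
        mul_comm]

theorem outputValue_nonneg : 0 ≤ outputValue vs es T p c := by
  unfold outputValue
  split
  · exact div_nonneg (Finset.sum_nonneg fun _ _ => by positivity) (by positivity)
  · positivity
  · positivity
  · exact growingValue_nonneg

theorem outputValue_le (hin : TreeInput vs es) (hI : Inv vs es c) :
    outputValue vs es T p c ≤ n + n.factorial := by
  classical
  have one_le (m : ℕ) : (1 : ℝ) ≤ m.factorial := by exact_mod_cast m.factorial_pos
  have ite_le (P : Prop) [Decidable P] : (if P then (1 : ℝ) else 0) ≤ n + n.factorial := by
    split_ifs <;> linarith [one_le n, n.cast_nonneg (α := ℝ)]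
  unfold outputValue
  split
  case h_1 i _ =>
    rw [Finset.sum_boole]
    refine (div_le_self (Nat.cast_nonneg _) (one_le i)).trans ?_
    refine le_trans ?_ (le_add_of_nonneg_left (Nat.cast_nonneg n))
    refine Nat.cast_le.2 ((Finset.card_le_univ _).trans ?_)
    rw [Fintype.card_perm, Fintype.card_fin]
  case h_2 => exact ite_le _
  case h_3 => exact ite_le _
  case h_4 => exact (growingValue_le hin hI).trans (le_add_of_nonneg_right (by positivity))

theorem outputValue_startWalk (h : c.phase = .choose) (v : Fin n) :
    outputValue vs es T p (startWalk c v) = outputValue vs es T p c := by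
  rw [outputValue_of_isGrowthPhase (show IsGrowthPhase .walk from trivial),
    outputValue_of_isGrowthPhase (by rw [h]; trivial)]
  simp only [growingValue, treeValue_startWalk h]

theorem sum_outputValue_moveTo (hin : TreeInput vs es) (hI : Inv vs es c) (hr : r ∈ vs.toFinset)
    (hp : ∀ π : Equiv.Perm (Fin n), ParentMap (T.comap π) r (p π)) (h : c.phase = .walk) {v : Fin n}
    {rest : List (Fin n)} (hpath : c.path = v :: rest) :
    ∑ u ∈ Finset.univ.erase v, outputValue vs es T p (moveTo c v u) =
      ((n : ℝ) - 1) * outputValue vs es T p c := by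
  have growth (u : Fin n) : IsGrowthPhase (moveTo c v u).phase := by
    unfold moveTo
    split_ifs <;> simp only [h, IsGrowthPhase]
  simp only [outputValue_of_isGrowthPhase (growth _),
    outputValue_of_isGrowthPhase (c := c) (by rw [h]; trivial), growingValue]
  rw [← Finset.sum_div, Finset.sum_comm, mul_div_assoc', Finset.mul_sum]
  simp only [sum_treeValue_moveTo hin hI hr (hp _) h hpath]

theorem sum_outputValue_shuffleTo {i : Fin n} (h : c.phase = .shuffle i.succ) :
    ∑ j ∈ Finset.Iic i, outputValue vs es T p (shuffleTo c i j) =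
      (Finset.Iic i).card * outputValue vs es T p c := by
  classical
  simp only [outputValue, shuffleTo, h, Fin.val_castSucc, Fin.val_succ, Fin.card_Iic,
    sum_fixing_succ, mul_assoc, ← Finset.sum_div, Nat.factorial_succ]
  push_cast
  field_simp

theorem outputValue_shuffle_last (hT : T.IsTree) (hI : Inv vs es c) (h : c.phase = .choose)
    (h0 : (c.free : ℕ) = 0) :
    outputValue vs es T p { c with phase := .shuffle (Fin.last n) } = outputValue vs es T p c := by
  classical
  simp only [Inv, h, treeSet_eq_univ h0] at hI
  have hspan : SpansTree c.edges Finset.univ := hI.2.spansTree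
  have grown_iff (π : Equiv.Perm (Fin n)) :
      edgeGraph (c.edges.map (Prod.map (c.label * π) (c.label * π))) = T ↔
        ∀ e ∈ c.edges, (T.comap π).Adj e.1 e.2 := by
    rw [hI.2.1, one_mul, edgeGraph_map_eq_iff, ← edgeGraph_le_iff hspan.ne]
    exact ⟨le_of_eq, eq_of_le_of_isTree hspan.isTree_edgeGraph (isTree_comap hT π)⟩
  have hn : 0 < n := hspan.nonempty.choose.pos
  simp only [outputValue, h, growingValue, treeValue, Fin.val_last, fixing_self, grown_iff,
    treeSet_eq_univ h0, Finset.card_univ, Fintype.card_fin, completionWeight_self hn]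

theorem DetStep.isGrowthPhase (hs : DetStep c b) (hb : IsGrowthPhase b.phase) :
    IsGrowthPhase c.phase := by
  cases hs <;> simp_all [IsGrowthPhase]

theorem DetStep.outputValue_eq (hI : Inv vs es c) (hr : r ∈ vs.toFinset) (hT : T.IsTree)
    (hp : ∀ π : Equiv.Perm (Fin n), ParentMap (T.comap π) r (p π)) (hs : DetStep c b) :
    outputValue vs es T p b = outputValue vs es T p c := by
  classical
  by_cases hb : IsGrowthPhase b.phase
  · rw [outputValue_of_isGrowthPhase hb, outputValue_of_isGrowthPhase (hs.isGrowthPhase hb)]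
    simp only [growingValue, hs.treeValue_eq hI hr (hp _) hb]
  cases hs with
  | choose_none h h0 => exact outputValue_shuffle_last hT hI h h0
  | shuffle_zero h =>
    simp only [Inv, h] at hI
    simp [outputValue, h, fixing_zero, hI.1]
  | relabel_nil h hE => simp only [outputValue, h, hE, List.map_nil, List.nil_append]
  | relabel_cons h hE => simp only [outputValue, h, hE, edgeGraph_relabel_cons]
  | _ => simp_all [IsGrowthPhase, attachHead]

theorem expect_draw_ofReal_eq {α : Type} {s : Finset α} (hs : s.Nonempty) {f : α → Config n}
    {h : Config n → ℝ} (h0 : ∀ a ∈ s, 0 ≤ h (f a)) {x : ℝ}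
    (hx : ∑ a ∈ s, h (f a) = s.card * x) :
    expect (draw s f c) (fun c => ENNReal.ofReal (h c)) = ENNReal.ofReal x := by
  have : (s.card : ℝ) ≠ 0 := by exact_mod_cast hs.card_ne_zero
  rw [expect_draw_ofReal hs h0, hx, mul_div_cancel_left₀ _ this]

theorem expect_step_outputValue (hin : TreeInput vs es) (hI : Inv vs es c) (hr : r ∈ vs.toFinset)
    (hT : T.IsTree) (hp : ∀ π : Equiv.Perm (Fin n), ParentMap (T.comap π) r (p π)) :
    expect (step ⊤ c) (fun c => ENNReal.ofReal (outputValue vs es T p c)) =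
      ENNReal.ofReal (outputValue vs es T p c) := by
  cases hI.stepCase with
  | det hs => rw [hs.step_eq, expect_pure, hs.outputValue_eq hI hr hT hp]
  | choose h h0 =>
    rw [step_choose h]
    refine expect_draw_ofReal_eq (freeSlots_nonempty h0) (fun _ _ => outputValue_nonneg) ?_
    simp only [outputValue_startWalk h, Finset.sum_const, nsmul_eq_mul]
  | walk h hpath =>
    rw [step_walk h hpath]
    refine expect_draw_ofReal_eq (moves_nonempty hin (hI.walk_growing h) hpath)
      (fun _ _ => outputValue_nonneg) ?_
    rw [card_moves, sum_outputValue_moveTo hin hI hr hp h hpath]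
  | shuffle h =>
    rw [step_shuffle h]
    exact expect_draw_ofReal_eq Finset.nonempty_Iic (fun _ _ => outputValue_nonneg)
      (sum_outputValue_shuffleTo h)
  | done h => rw [step_done h, expect_pure]

theorem tsum_not_done_ne_top (hin : TreeInput vs es) :
    ∑' t, (chain (step ⊤) (start vs es) t).toOuterMeasure
      ({c : Config n | c.phase = .done} : Set (Config n))ᶜ ≠ ∞ := by
  have finite : expectedTime vs es ≠ ∞ :=
    ne_top_of_le_ne_top (ENNReal.mul_ne_top (by norm_num) (by simp)) (expectedTime_le hin)
  simp only [expectedTime, law_eq_chain] at finite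
  exact finite

theorem outputProb_eq_outputValue (hin : TreeInput vs es) (hr : r ∈ vs.toFinset) (hT : T.IsTree)
    (hp : ∀ π : Equiv.Perm (Fin n), ParentMap (T.comap π) r (p π)) :
    outputProb vs es T = ENNReal.ofReal (outputValue vs es T p (start vs es)) := by
  simp only [outputProb, law_eq_chain]
  refine iSup_chain_eq_of_harmonic (D := {c : Config n | c.phase = .done})
    (B := ENNReal.ofReal (n + n.factorial)) inv_start (inv_step hin)
    (h := fun c => ENNReal.ofReal (outputValue vs es T p c))
    (fun c hI => expect_step_outputValue hin hI hr hT hp) (fun c hc => hc.1) ?_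
    ENNReal.ofReal_ne_top (fun c hI => ENNReal.ofReal_le_ofReal (outputValue_le hin hI))
    (tsum_not_done_ne_top hin)
  classical
  rintro c (hc : c.phase = .done) -
  have result_eq : c.result = edgeGraph c.out := rfl
  simp only [outputValue, hc, Set.indicator_apply, Set.mem_ofPred_eq, true_and, result_eq,
    Pi.one_apply]
  split_ifs <;> simp

theorem outputProb_eq (hin : TreeInput vs es) (hT : T.IsTree) :
    outputProb vs es T =
      ENNReal.ofReal (completionWeight n vs.toFinset.card / n.factorial) *
        (Nat.card {π : Equiv.Perm (Fin n) // ∀ e ∈ es, T.Adj (π e.1) (π e.2)} : ℝ≥0∞) := by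
  classical
  obtain ⟨r, hr⟩ := hin.spans.nonempty
  choose p hp using fun π => exists_parentMap (isTree_comap hT π) r
  rw [outputProb_eq_outputValue hin hr hT hp, ← ENNReal.ofReal_natCast,
    ← ENNReal.ofReal_mul (div_nonneg (completionWeight_nonneg _ _) (by positivity))]
  congr 1
  simp only [outputValue, start, growingValue, treeValue, SimpleGraph.comap_adj]
  rw [← Finset.sum_filter, Finset.sum_const, nsmul_eq_mul, Nat.card_eq_fintype_card,
    Fintype.card_subtype]
  ring

theorem outputProb_of_not_isTree (hin : TreeInput vs es) (hT : ¬T.IsTree) :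
    outputProb vs es T = 0 := by
  simp only [outputProb, law_eq_chain, ENNReal.iSup_eq_zero]
  intro t
  rw [PMF.toOuterMeasure_apply_eq_zero_iff, Set.disjoint_left]
  rintro c hc ⟨hdone, rfl⟩
  have hI := chain_invariant inv_start (inv_step hin) t c hc
  simp only [Inv, hdone] at hI
  exact hT hI.2

theorem iSup_chain_done (hin : TreeInput vs es) :
    ⨆ t, (chain (step ⊤) (start vs es) t).toOuterMeasure {c : Config n | c.phase = .done} = 1 :=
  iSup_chain_eq_of_harmonic inv_start (inv_step hin) (h := fun _ => 1) (fun _ _ => expect_one _)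
    subset_rfl (fun c hc _ => by rw [Set.indicator_of_mem hc, Pi.one_apply]) ENNReal.one_ne_top
    (fun _ _ => le_rfl) (tsum_not_done_ne_top hin)

theorem tsum_outputProb (hin : TreeInput vs es) :
    ∑' T : SimpleGraph (Fin n), outputProb vs es T = 1 := by
  classical
  have := Fintype.ofFinite (SimpleGraph (Fin n))
  simp only [tsum_fintype, ← iSup_chain_done hin, outputProb, law_eq_chain]
  rw [ENNReal.finsetSum_iSup_of_monotone fun T => chain_monotone_of_absorbing fun c hc =>
    step_done hc.1]
  congr 1
  funext t
  simp only [toOuterMeasure_eq_expect]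
  rw [← expect_sum]
  refine expect_congr fun c _ => ?_
  by_cases hc : c.phase = .done <;> simp [Set.indicator_apply, hc]

end Output

/-! ## Counting the copies of a tree -/

section Copies

variable {V : Type*} {G T : SimpleGraph V} {τ : G.Subgraph} {S S' : T.Subgraph} {π : Equiv.Perm V}

/-- The permutation `π` maps the subgraph `τ` onto `S`. -/
structure MapsOnto (τ : G.Subgraph) (S : T.Subgraph) (π : Equiv.Perm V) : Prop where
  mem_iff : ∀ a, π a ∈ S.verts ↔ a ∈ τ.verts
  adj_iff : ∀ a b, S.Adj (π a) (π b) ↔ τ.Adj a b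

theorem MapsOnto.map_adj (h : MapsOnto τ S π) {a b : V} (hab : τ.Adj a b) : T.Adj (π a) (π b) :=
  ((h.adj_iff a b).2 hab).adj_sub

theorem MapsOnto.unique (h : MapsOnto τ S π) (h' : MapsOnto τ S' π) : S = S' := by
  refine SimpleGraph.Subgraph.ext ?_ ?_
  · ext v
    obtain ⟨a, rfl⟩ := π.surjective v
    rw [h.mem_iff, h'.mem_iff]
  · ext v w
    obtain ⟨a, rfl⟩ := π.surjective v
    obtain ⟨b, rfl⟩ := π.surjective w
    rw [h.adj_iff, h'.adj_iff]

theorem MapsOnto.nonempty_iso (h : MapsOnto τ S π) : Nonempty (S.coe ≃g τ.coe) :=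
  ⟨SimpleGraph.Iso.symm
    { toEquiv := π.subtypeEquiv fun a => (h.mem_iff a).symm
      map_rel_iff' := fun {a b} => h.adj_iff a b }⟩

theorem exists_mapsOnto_of_map_adj (h : ∀ a b, τ.Adj a b → T.Adj (π a) (π b)) :
    ∃ S : T.Subgraph, MapsOnto τ S π := by
  let image : T.Subgraph :=
    { verts := {v | π.symm v ∈ τ.verts}
      Adj := fun a b => τ.Adj (π.symm a) (π.symm b)
      adj_sub := fun {a b} hab => by simpa using h _ _ hab
      edge_vert := fun hab => hab.fst_mem
      symm := ⟨fun _ _ hab => hab.symm⟩ }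
  exact ⟨image, fun a => by simp [image], fun a b => by simp [image]⟩

theorem MapsOnto.mul_iff {π₀ : Equiv.Perm V} (h₀ : MapsOnto τ S π₀) :
    MapsOnto τ S (π₀ * π) ↔ MapsOnto τ τ π :=
  ⟨fun h => ⟨fun a => (h₀.mem_iff _).symm.trans (h.mem_iff a),
      fun a b => (h₀.adj_iff _ _).symm.trans (h.adj_iff a b)⟩,
    fun h => ⟨fun a => (h₀.mem_iff _).trans (h.mem_iff a),
      fun a b => (h₀.adj_iff _ _).trans (h.adj_iff a b)⟩⟩

variable [Finite V]

theorem exists_mapsOnto_of_iso (φ : S.coe ≃g τ.coe) : ∃ π, MapsOnto τ S π := by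
  classical
  have := Fintype.ofFinite V
  let e : τ.verts ≃ S.verts := φ.symm.toEquiv
  have mem_iff (a : V) : e.extendSubtype a ∈ S.verts ↔ a ∈ τ.verts := by
    by_cases ha : a ∈ τ.verts
    · exact iff_of_true (e.extendSubtype_mem a ha) ha
    · exact iff_of_false (e.extendSubtype_not_mem a ha) ha
  refine ⟨e.extendSubtype, mem_iff, fun a b => ?_⟩
  by_cases hab : a ∈ τ.verts ∧ b ∈ τ.verts
  · rw [e.extendSubtype_apply_of_mem a hab.1, e.extendSubtype_apply_of_mem b hab.2]
    exact φ.symm.map_adj_iff (v := ⟨a, hab.1⟩) (w := ⟨b, hab.2⟩)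
  · exact iff_of_false (fun h => hab ⟨(mem_iff a).1 h.fst_mem, (mem_iff b).1 h.snd_mem⟩)
      fun h => hab ⟨h.fst_mem, h.snd_mem⟩

theorem card_mapsOnto (φ : S.coe ≃g τ.coe) :
    Nat.card {π // MapsOnto τ S π} = Nat.card {π // MapsOnto τ τ π} := by
  obtain ⟨π₀, h₀⟩ := exists_mapsOnto_of_iso φ
  exact Nat.card_congr ((Equiv.mulLeft π₀).subtypeEquiv fun _ => h₀.mul_iff.symm).symm

theorem card_perm_map_adj (τ : G.Subgraph) (T : SimpleGraph V) :
    Nat.card {π : Equiv.Perm V // ∀ a b, τ.Adj a b → T.Adj (π a) (π b)} =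
      Nat.card {S : T.Subgraph // Nonempty (S.coe ≃g τ.coe)} *
        Nat.card {π // MapsOnto τ τ π} := by
  let toPerm (x : Σ S : {S : T.Subgraph // Nonempty (S.coe ≃g τ.coe)}, {π // MapsOnto τ S.1 π}) :
      {π : Equiv.Perm V // ∀ a b, τ.Adj a b → T.Adj (π a) (π b)} :=
    ⟨x.2.1, fun _ _ => x.2.2.map_adj⟩
  have injective : Function.Injective toPerm := by
    rintro ⟨⟨S, hS⟩, π, h⟩ ⟨⟨S', hS'⟩, π', h'⟩ heq
    obtain rfl : π = π' := congrArg Subtype.val heq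
    obtain rfl : S = S' := h.unique h'
    rfl
  have surjective : Function.Surjective toPerm := by
    rintro ⟨π, hπ⟩
    obtain ⟨S, h⟩ := exists_mapsOnto_of_map_adj hπ
    exact ⟨⟨⟨S, h.nonempty_iso⟩, π, h⟩, rfl⟩
  have := Fintype.ofFinite {S : T.Subgraph // Nonempty (S.coe ≃g τ.coe)}
  rw [← Nat.card_eq_of_bijective toPerm ⟨injective, surjective⟩, Nat.card_sigma,
    Finset.sum_congr rfl fun S _ => card_mapsOnto S.2.some, Finset.sum_const, smul_eq_mul,
    Finset.card_univ, ← Nat.card_eq_fintype_card]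

end Copies

section Encoding

variable {n : ℕ} {τ : (⊤ : SimpleGraph (Fin n)).Subgraph} {vs : List (Fin n)}
  {es : List (Fin n × Fin n)}

theorem Encodes.adj_iff (h : Encodes τ vs es) {a b : Fin n} :
    τ.Adj a b ↔ (a, b) ∈ es ∨ (b, a) ∈ es := by
  rw [← SimpleGraph.Subgraph.mem_edgeSet, ← h.2.2.2, List.mem_map]
  constructor
  · rintro ⟨⟨x, y⟩, he, heq⟩
    rcases Sym2.eq_iff.1 heq with ⟨rfl, rfl⟩ | ⟨rfl, rfl⟩
    · exact Or.inl he
    · exact Or.inr he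
  · rintro (he | he)
    · exact ⟨_, he, rfl⟩
    · exact ⟨_, he, Sym2.eq_swap⟩

theorem Encodes.adj (h : Encodes τ vs es) {e : Fin n × Fin n} (he : e ∈ es) : τ.Adj e.1 e.2 :=
  h.adj_iff.2 (Or.inl he)

theorem Encodes.card_verts (h : Encodes τ vs es) : Nat.card τ.verts = vs.toFinset.card := by
  have verts_eq : τ.verts = (vs.toFinset : Set (Fin n)) := by
    ext v
    simp [h.2.1]
  rw [verts_eq, Nat.card_coe_set_eq, Set.ncard_coe_finset]

theorem Encodes.card_edgeSet (h : Encodes τ vs es) : Nat.card τ.coe.edgeSet = es.length := by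
  have edgeSet_eq : τ.edgeSet = ((es.map fun e => s(e.1, e.2)).toFinset : Set (Sym2 (Fin n))) := by
    ext e
    rw [← h.2.2.2]
    simp
  rw [Nat.card_coe_set_eq, ← Set.ncard_image_of_injective _
    (Sym2.map.injective Subtype.val_injective), SimpleGraph.Subgraph.image_coe_edgeSet_coe,
    edgeSet_eq, Set.ncard_coe_finset, List.toFinset_card_of_nodup h.2.2.1, List.length_map]

theorem Encodes.treeInput (h : Encodes τ vs es) (hτ : τ.coe.IsTree) : TreeInput vs es := by
  have mem_iff (v : Fin n) : v ∈ vs.toFinset ↔ v ∈ τ.verts := by rw [List.mem_toFinset, h.2.1]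
  let hom : τ.coe →g edgeGraph es :=
    ⟨Subtype.val, fun hab => edgeGraph_adj.2 ⟨h.adj_iff.1 hab, SimpleGraph.Subgraph.Adj.ne hab⟩⟩
  refine ⟨h.1, ?_, fun e he => ?_, fun e he => (h.adj he).ne, fun a ha b hb => ?_, ?_⟩
  · obtain ⟨v⟩ := hτ.1.nonempty
    exact ⟨v, (mem_iff v).2 v.2⟩
  · exact ⟨(mem_iff _).2 (h.adj he).fst_mem, (mem_iff _).2 (h.adj he).snd_mem⟩
  · exact (hτ.1 ⟨a, (mem_iff a).1 ha⟩ ⟨b, (mem_iff b).1 hb⟩).map hom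
  · rw [← h.card_verts, ← h.card_edgeSet]
    exact (SimpleGraph.isTree_iff_connected_and_card.1 hτ).2

theorem Encodes.forall_adj_iff (h : Encodes τ vs es) (T : SimpleGraph (Fin n))
    (π : Equiv.Perm (Fin n)) :
    (∀ e ∈ es, T.Adj (π e.1) (π e.2)) ↔ ∀ a b, τ.Adj a b → T.Adj (π a) (π b) := by
  refine ⟨fun hT a b hab => ?_, fun hT e he => hT _ _ (h.adj he)⟩
  rcases h.adj_iff.1 hab with he | he
  · exact hT _ he
  · exact (hT _ he).symm

theorem exists_outputProb_eq_mul_copies (h : Encodes τ vs es) (hτ : τ.coe.IsTree) :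
    ∃ κ : ℝ≥0∞, ∀ T : SimpleGraph (Fin n), T.IsTree → outputProb vs es T = κ * copies τ T := by
  refine ⟨ENNReal.ofReal (completionWeight n vs.toFinset.card / n.factorial) *
    (Nat.card {π // MapsOnto τ τ π} : ℝ≥0∞), fun T hT => ?_⟩
  simp only [outputProb_eq (h.treeInput hτ) hT, h.forall_adj_iff T, card_perm_map_adj, copies,
    Nat.cast_mul]
  ring

theorem outputProb_eq_div (h : Encodes τ vs es) (hτ : τ.coe.IsTree) {T : SimpleGraph (Fin n)}
    (hT : T.IsTree) :
    outputProb vs es T = (copies τ T : ℝ≥0∞) /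
      ∑' T' : {T' : SimpleGraph (Fin n) // T'.IsTree}, (copies τ T'.1 : ℝ≥0∞) := by
  obtain ⟨κ, hκ⟩ := exists_outputProb_eq_mul_copies h hτ
  have hin := h.treeInput hτ
  have support_subset : (Function.support fun T' => outputProb vs es T') ⊆ {T' | T'.IsTree} :=
    fun T' hT' => by_contra fun hn => hT' (outputProb_of_not_isTree hin hn)
  have total : κ * ∑' T' : {T' : SimpleGraph (Fin n) // T'.IsTree}, (copies τ T'.1 : ℝ≥0∞) = 1 := by
    rw [← ENNReal.tsum_mul_left, ← tsum_outputProb hin,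
      ← tsum_subtype_eq_of_support_subset support_subset]
    exact tsum_congr fun T' => (hκ T'.1 T'.2).symm
  rw [hκ T hT, ENNReal.eq_inv_of_mul_eq_one_left total, ENNReal.div_eq_inv_mul]

end Encoding

end SeededTree

end

theorem mainTheorem9 :
    ∃ C : ℝ≥0, ∀ (n : ℕ) (τ : (⊤ : SimpleGraph (Fin n)).Subgraph), τ.coe.IsTree →
      ∀ (vs : List (Fin n)) (es : List (Fin n × Fin n)), SeededTree.Encodes τ vs es →
        (∀ T : SimpleGraph (Fin n), T.IsTree →
          SeededTree.outputProb vs es T =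
            (SeededTree.copies τ T : ℝ≥0∞) /
              ∑' T' : {T' : SimpleGraph (Fin n) // T'.IsTree},
                (SeededTree.copies τ T'.1 : ℝ≥0∞)) ∧
        (∀ T : SimpleGraph (Fin n), ¬ T.IsTree → SeededTree.outputProb vs es T = 0) ∧
        (∑' T : SimpleGraph (Fin n), SeededTree.outputProb vs es T = 1) ∧
        SeededTree.expectedTime vs es ≤ (C : ℝ≥0∞) * (n : ℝ≥0∞) := by
  refine ⟨15, fun n τ hτ vs es h => ?_⟩
  have hin : SeededTree.TreeInput vs es := h.treeInput hτ
  refine ⟨fun T hT => SeededTree.outputProb_eq_div h hτ hT,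
    fun T hT => SeededTree.outputProb_of_not_isTree hin hT, SeededTree.tsum_outputProb hin, ?_⟩
  exact_mod_cast SeededTree.expectedTime_le hin
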